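/- Let $\tau_i\ge 0$, $m_e>0$, $c=\sqrt{(1+\tau_i)/(1+m_e)}$, and let $m\ge 1$. Consider functions $n_\pm^{(k)},v_\pm^{(k)},\phi^{(k)}$ of $(Y,T)\in\mathbb R\times[0,\infty)$, $1\le k\le m$, continuous in $Y$, with $n_\pm^{(k)},v_\pm^{(k)}$ differentiable in $T$, which solve the following long-wavelength (Gardner–Morikawa) hierarchy of the two-fluid Euler–Poisson system for all $T\ge0$. (a) Coefficient of $\varepsilon^1$: $$\partial_Yv_\pm^{(1)}=c\,\partial_Yn_\pm^{(1)},\quad \tau_i\partial_Yn_+^{(1)}-c\,\partial_Yv_+^{(1)}+\partial_Y\phi^{(1)}=0,\quad \partial_Yn_-^{(1)}-cm_e\partial_Yv_-^{(1)}-\partial_Y\phi^{(1)}=0,\quad n_+^{(1)}=n_-^{(1)}.$$ (b) Coefficients of $\varepsilon^{k+1}$, for $1\le k\le m-1$: $$\partial_Tn_\pm^{(k)}+\partial_Yv_\pm^{(k+1)}+\partial_Y\sum_{j=1}^kn_\pm^{(j)}v_\pm^{(k+1-j)}-c\,\partial_Yn_\pm^{(k+1)}=0,$$ $$\partial_Tv_+^{(k)}-c\,\partial_Yv_+^{(k+1)}+\tfrac12\partial_Y\sum_{j=1}^kv_+^{(j)}v_+^{(k+1-j)}+\tau_i\partial_Y\ell_+^{(k+1)}+\partial_Y\phi^{(k+1)}=0,$$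 $$m_e\Big(\partial_Tv_-^{(k)}-c\,\partial_Yv_-^{(k+1)}+\tfrac12\partial_Y\sum_{j=1}^kv_-^{(j)}v_-^{(k+1-j)}\Big)+\partial_Y\ell_-^{(k+1)}-\partial_Y\phi^{(k+1)}=0,$$ $$\partial_Y^2\phi^{(k)}+n_+^{(k+1)}-n_-^{(k+1)}=0,$$ where $\ell_\pm^{(K)}=\sum_{j=1}^{K}\frac{(-1)^{j+1}}{j}\sum\binom{j}{a_1,\dots,a_K}\prod_{i=1}^K(n_\pm^{(i)})^{a_i}$, the inner sum being over integers $a_i\ge0$ with $\sum a_i=j$, $\sum i\,a_i=K$. (c) For $1\le k\le m$: $n_-^{(k)}=n_+^{(k)}+f^{(k-1)}$, $v_+^{(k)}=c\,n_+^{(k)}+g^{(k-1)}$, $v_-^{(k)}=c\,n_+^{(k)}+h^{(k-1)}$, and, with $d=\frac{(c^2m_e-1)^2}{2c(1+m_e)}$, $$\partial_Tn_+^{(1)}+c\,n_+^{(1)}\partial_Yn_+^{(1)}+d\,\partial_Y^3n_+^{(1)}=0,\qquad \partial_Tn_+^{(k)}+c\,\partial_Y\big(n_+^{(1)}n_+^{(k)}\big)+d\,\partial_Y^3n_+^{(k)}=F^{(k-1)}\quad(2\le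 k\le m).$$ Here $f^{(k)},g^{(k)},h^{(k)},F^{(k)}$ are differential polynomials (polynomials without constant term in the functions $n_+^{(1)},\dots,n_+^{(k)}$ and their $Y$-derivatives; all zero for $k=0$), which are regarded as fixed. For $0<\varepsilon\le1$ put $Y=\varepsilon^{1/2}(x-ct)$, $T=\varepsilon^{3/2}t$ and $$N_\pm^{(m)}=1+\sum_{k=1}^m\varepsilon^kn_\pm^{(k)}(Y,T),\quad V_\pm^{(m)}=\sum_{k=1}^m\varepsilon^kv_\pm^{(k)}(Y,T),\quad \Phi^{(m)}=\sum_{k=1}^m\varepsilon^k\phi^{(k)}(Y,T),$$ regarded as functions of $(x,t)$, and define the error-scaled residuals $$\mathrm{Res}_{n_\pm}^{(m)}=-\varepsilon^{1-m}\big[\partial_tN_\pm^{(m)}+\partial_x(N_\pm^{(m)}V_\pm^{(m)})\big],$$ $$\mathrm{Res}_{v_+}^{(m)}=-\varepsilon^{1-m}\Big[\partial_tV_+^{(m)}+\tfrac12\partial_x(V_+^{(m)})^2+\tau_i\sum_{k=1}^m\tfrac{(-1)^{k+1}}k\partial_x(N_+^{(m)}-1)^k+\partial_x\Phi^{(m)}\Big],$$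 $$\mathrm{Res}_{v_-}^{(m)}=-\varepsilon^{1-m}\Big[m_e\big(\partial_tV_-^{(m)}+\tfrac12\partial_x(V_-^{(m)})^2\big)+\sum_{k=1}^m\tfrac{(-1)^{k+1}}k\partial_x(N_-^{(m)}-1)^k-\partial_x\Phi^{(m)}\Big],$$ $$\mathrm{Res}_{\phi}^{(m)}=-\varepsilon^{1-m}\big[\partial_x^2\Phi^{(m)}-N_-^{(m)}+N_+^{(m)}\big].$$ **Theorem.** Fix $\tau_i$, $m_e$, $m\ge1$ and the differential polynomials in (c). For every sufficiently large integer $s$ and every $M\ge 0$ there is a constant $C>0$ such that for every solution of the hierarchy (a)–(c) with $$\sup_{T\ge0}\ \sum_{k=1}^m\Big(\|n_+^{(k)}\|_{H^s}+\|n_-^{(k)}\|_{H^s}+\|v_+^{(k)}\|_{H^s}+\|v_-^{(k)}\|_{H^s}+\|\phi^{(k)}\|_{H^s}\Big)(T)\le M$$ (norms in $H^s(\mathbb R)$ with respect to $Y$) and every $0<\varepsilon\le1$, $$\sup_{t\ge0}\|\mathrm{Res}_{n_\pm}^{(m)}(\cdot,t)\|_{L^2(x)}\le C\varepsilon^{9/4},\qquad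 \sup_{t\ge0}\|\mathrm{Res}_{v_\pm}^{(m)}(\cdot,t)\|_{L^2(x)}\le C\varepsilon^{9/4},\qquad \sup_{t\ge0}\|\mathrm{Res}_{\phi}^{(m)}(\cdot,t)\|_{L^2(x)}\le C\varepsilon^{7/4}.$$ -/

import Mathlib

open MeasureTheory
open scoped ENNReal NNReal

noncomputable section

namespace EulerPoisson

/-! ### Sobolev norm on the line -/

/-- `w` is the weak derivative of `u` on `ℝ`. -/
def HasWeakDeriv (u w : ℝ → ℝ) : Prop :=
  LocallyIntegrable u ∧ LocallyIntegrable w ∧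
    ∀ θ : ℝ → ℝ, ContDiff ℝ (⊤ : ℕ∞) θ → HasCompactSupport θ →
      ∫ y, u y * deriv θ y = -∫ y, w y * θ y

/-- `w 0 = u, w 1, …, w s` are the successive weak derivatives of `u`, all in `L²(ℝ)`. -/
def IsSobolevChain (s : ℕ) (u : ℝ → ℝ) (w : ℕ → ℝ → ℝ) : Prop :=
  w 0 = u ∧ (∀ i ≤ s, MemLp (w i) 2 volume) ∧ ∀ i < s, HasWeakDeriv (w i) (w (i + 1))

/-- The `H^s(ℝ)` norm `(∑_{i ≤ s} ‖∂^i u‖²_{L²})^{1/2}`; it is `⊤` when `u ∉ H^s(ℝ)`. Weak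
derivatives are unique almost everywhere, so the infimum is over equal values. -/
def hsNorm (s : ℕ) (u : ℝ → ℝ) : ℝ≥0∞ :=
  ⨅ (w : ℕ → ℝ → ℝ) (_ : IsSobolevChain s u w),
    (∑ i ∈ Finset.range (s + 1), eLpNorm (w i) 2 volume ^ (2 : ℝ)) ^ (1 / 2 : ℝ)

/-! ### Partial derivatives of functions of (space, time), time being `≥ 0` -/

/-- Derivative in the space variable. -/
def dSpace (u : ℝ → ℝ → ℝ) : ℝ → ℝ → ℝ := fun y τ => deriv (fun z => u z τ) y

/-- Derivative in the time variable on `[0, ∞)` (one-sided at time `0`). -/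
def dTime (u : ℝ → ℝ → ℝ) : ℝ → ℝ → ℝ := fun y τ => derivWithin (fun r => u y r) (Set.Ici 0) τ

/-! ### The long-wavelength hierarchy -/

/-- The speed of sound: `c² = (1 + τ_i) / (1 + m_e)`, `c > 0`. -/
def soundSpeed (τi me : ℝ) : ℝ := Real.sqrt ((1 + τi) / (1 + me))

/-- The coefficient functions `n_±^{(k)}, v_±^{(k)}, φ^{(k)}` of `(Y, T)`, for `k ≥ 1`
(the values at `k = 0` are never used). -/
structure Profiles where
  nP : ℕ → ℝ → ℝ → ℝ
  nM : ℕ → ℝ → ℝ → ℝ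
  vP : ℕ → ℝ → ℝ → ℝ
  vM : ℕ → ℝ → ℝ → ℝ
  φ : ℕ → ℝ → ℝ → ℝ

/-- `∑_{j=1}^{k} a^{(j)} b^{(k+1-j)}`. -/
def conv (a b : ℕ → ℝ → ℝ → ℝ) (k : ℕ) : ℝ → ℝ → ℝ := fun Y T =>
  ∑ j ∈ Finset.Icc 1 k, a j Y T * b (k + 1 - j) Y T

/-- `ℓ^{(K)}`, the coefficient of `ε^K` in `ln (1 + ε n^{(1)} + ε² n^{(2)} + ⋯)`:
the inner sum is over `a_1, …, a_K ≥ 0` with `∑ a_i = j` and `∑ i a_i = K`. -/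
def ell (n : ℕ → ℝ → ℝ → ℝ) (K : ℕ) : ℝ → ℝ → ℝ := fun Y T =>
  ∑ j ∈ Finset.Icc 1 K, ((-1 : ℝ) ^ (j + 1) / j) *
    ∑ a ∈ (Finset.piAntidiag (Finset.Icc 1 K) j).filter
        (fun a => ∑ i ∈ Finset.Icc 1 K, i * a i = K),
      (Nat.multinomial (Finset.Icc 1 K) a : ℝ) * ∏ i ∈ Finset.Icc 1 K, n i Y T ^ a i

/-- The system obtained from the coefficients of `ε^1`. -/
def EvolutionZero (τi me : ℝ) (P : Profiles) : Prop :=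
  let c := soundSpeed τi me
  ∀ Y T : ℝ, 0 ≤ T →
    dSpace (P.vP 1) Y T - c * dSpace (P.nP 1) Y T = 0 ∧
    dSpace (P.vM 1) Y T - c * dSpace (P.nM 1) Y T = 0 ∧
    τi * dSpace (P.nP 1) Y T - c * dSpace (P.vP 1) Y T + dSpace (P.φ 1) Y T = 0 ∧
    dSpace (P.nM 1) Y T - c * me * dSpace (P.vM 1) Y T - dSpace (P.φ 1) Y T = 0 ∧
    P.nP 1 Y T - P.nM 1 Y T = 0

/-- The system obtained from the coefficients of `ε^(k+1)`, `k ≥ 1`. -/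
def Evolution (τi me : ℝ) (P : Profiles) (k : ℕ) : Prop :=
  let c := soundSpeed τi me
  ∀ Y T : ℝ, 0 ≤ T →
    dTime (P.nP k) Y T + dSpace (P.vP (k + 1)) Y T + dSpace (conv P.nP P.vP k) Y T
      - c * dSpace (P.nP (k + 1)) Y T = 0 ∧
    dTime (P.nM k) Y T + dSpace (P.vM (k + 1)) Y T + dSpace (conv P.nM P.vM k) Y T
      - c * dSpace (P.nM (k + 1)) Y T = 0 ∧
    dTime (P.vP k) Y T - c * dSpace (P.vP (k + 1)) Y T
      + 1 / 2 * dSpace (conv P.vP P.vP k) Y T + τi * dSpace (ell P.nP (k + 1)) Y T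
      + dSpace (P.φ (k + 1)) Y T = 0 ∧
    me * (dTime (P.vM k) Y T - c * dSpace (P.vM (k + 1)) Y T
      + 1 / 2 * dSpace (conv P.vM P.vM k) Y T) + dSpace (ell P.nM (k + 1)) Y T
      - dSpace (P.φ (k + 1)) Y T = 0 ∧
    dSpace (dSpace (P.φ k)) Y T + P.nP (k + 1) Y T - P.nM (k + 1) Y T = 0

/-- A differential polynomial in `n^{(1)}, …, n^{(k)}` without constant term: the variable
`(j, i)` stands for `∂_Y^i n^{(j)}`. -/
def IsDiffPoly (k : ℕ) (p : MvPolynomial (ℕ × ℕ) ℝ) : Prop :=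
  (∀ ι ∈ p.vars, 1 ≤ ι.1 ∧ ι.1 ≤ k) ∧ MvPolynomial.constantCoeff p = 0

/-- The function of `(Y, T)` that a differential polynomial defines. -/
def evalJet (p : MvPolynomial (ℕ × ℕ) ℝ) (n : ℕ → ℝ → ℝ → ℝ) : ℝ → ℝ → ℝ := fun Y T =>
  MvPolynomial.eval (fun ι : ℕ × ℕ => iteratedDeriv ι.2 (fun y => n ι.1 y T) Y) p

/-- The lower order corrections `f^{(k)}, g^{(k)}, h^{(k)}` in the relations that express
`n_-^{(k+1)}, v_±^{(k+1)}` through `n_+^{(k+1)}`, and the source `F^{(k)}` in the linearized KdV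
equation for `n_+^{(k+1)}`. Each depends only on `n_+^{(1)}, …, n_+^{(k)}`; in particular all
four vanish for `k = 0`. -/
structure LocalRelations where
  f : ℕ → MvPolynomial (ℕ × ℕ) ℝ
  g : ℕ → MvPolynomial (ℕ × ℕ) ℝ
  h : ℕ → MvPolynomial (ℕ × ℕ) ℝ
  F : ℕ → MvPolynomial (ℕ × ℕ) ℝ
  isDiffPoly : ∀ k, IsDiffPoly k (f k) ∧ IsDiffPoly k (g k) ∧ IsDiffPoly k (h k) ∧
    IsDiffPoly k (F k)

/-- The relations for `n_-^{(k)}, v_+^{(k)}, v_-^{(k)}` in terms of `n_+^{(k)}`, `k ≥ 1`. -/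
def Slaved (τi me : ℝ) (R : LocalRelations) (P : Profiles) (k : ℕ) : Prop :=
  let c := soundSpeed τi me
  ∀ Y T : ℝ, 0 ≤ T →
    P.nM k Y T = P.nP k Y T + evalJet (R.f (k - 1)) P.nP Y T ∧
    P.vP k Y T = c * P.nP k Y T + evalJet (R.g (k - 1)) P.nP Y T ∧
    P.vM k Y T = c * P.nP k Y T + evalJet (R.h (k - 1)) P.nP Y T

/-- The dispersion coefficient of the KdV equations. -/
def dispersion (τi me : ℝ) : ℝ :=
  (soundSpeed τi me ^ 2 * me - 1) ^ 2 / (2 * soundSpeed τi me * (1 + me))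

/-- The KdV equation for `n_+^{(1)}`. -/
def KdVOne (τi me : ℝ) (P : Profiles) : Prop :=
  ∀ Y T : ℝ, 0 ≤ T →
    dTime (P.nP 1) Y T + soundSpeed τi me * (P.nP 1 Y T * dSpace (P.nP 1) Y T)
      + dispersion τi me * dSpace (dSpace (dSpace (P.nP 1))) Y T = 0

/-- The linearized inhomogeneous KdV equation for `n_+^{(k)}`, `k ≥ 2`. -/
def KdVLin (τi me : ℝ) (R : LocalRelations) (P : Profiles) (k : ℕ) : Prop :=
  ∀ Y T : ℝ, 0 ≤ T →
    dTime (P.nP k) Y T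
      + soundSpeed τi me * dSpace (fun y r => P.nP 1 y r * P.nP k y r) Y T
      + dispersion τi me * dSpace (dSpace (dSpace (P.nP k))) Y T
      = evalJet (R.F (k - 1)) P.nP Y T

/-- `P` solves the hierarchy up to level `m` for all `T ≥ 0`, classically: all coefficients of
`ε^1, …, ε^m` vanish, and `n_+^{(1)}, …, n_+^{(m)}` solve their KdV equations. -/
structure IsApproximateSolution (τi me : ℝ) (m : ℕ) (R : LocalRelations) (P : Profiles) :
    Prop where
  /-- Each profile is the continuous representative of its class in `Y`. -/
  continuous_space : ∀ k, 1 ≤ k → k ≤ m → ∀ T, 0 ≤ T →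
    Continuous (fun Y => P.nP k Y T) ∧ Continuous (fun Y => P.nM k Y T) ∧
    Continuous (fun Y => P.vP k Y T) ∧ Continuous (fun Y => P.vM k Y T) ∧
    Continuous (fun Y => P.φ k Y T)
  /-- The time derivatives in the equations exist. -/
  differentiable_time : ∀ k, 1 ≤ k → k ≤ m → ∀ Y,
    DifferentiableOn ℝ (fun T => P.nP k Y T) (Set.Ici 0) ∧
    DifferentiableOn ℝ (fun T => P.nM k Y T) (Set.Ici 0) ∧
    DifferentiableOn ℝ (fun T => P.vP k Y T) (Set.Ici 0) ∧
    DifferentiableOn ℝ (fun T => P.vM k Y T) (Set.Ici 0)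
  evolution_zero : EvolutionZero τi me P
  evolution : ∀ k, 1 ≤ k → k + 1 ≤ m → Evolution τi me P k
  slaved : ∀ k, 1 ≤ k → k ≤ m → Slaved τi me R P k
  kdv_one : KdVOne τi me P
  kdv_lin : ∀ k, 2 ≤ k → k ≤ m → KdVLin τi me R P k

/-- The sum of the `H^s(Y)` norms of all profiles of levels `1, …, m` at time `T`. -/
def profileNorm (s m : ℕ) (P : Profiles) (T : ℝ) : ℝ≥0∞ :=
  ∑ k ∈ Finset.Icc 1 m,
    (hsNorm s (fun Y => P.nP k Y T) + hsNorm s (fun Y => P.nM k Y T) +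
      hsNorm s (fun Y => P.vP k Y T) + hsNorm s (fun Y => P.vM k Y T) +
      hsNorm s (fun Y => P.φ k Y T))

/-! ### Truncated expansions and residuals, as functions of `(x, t)` -/

/-- `∑_{k=1}^{m} ε^k a^{(k)}(ε^{1/2} (x - c t), ε^{3/2} t)`; this is `V_±^{(m)}` or `Φ^{(m)}`. -/
def truncated (c ε : ℝ) (m : ℕ) (a : ℕ → ℝ → ℝ → ℝ) : ℝ → ℝ → ℝ := fun x t =>
  ∑ k ∈ Finset.Icc 1 m, ε ^ k * a k (ε ^ (1 / 2 : ℝ) * (x - c * t)) (ε ^ (3 / 2 : ℝ) * t)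

/-- `N_±^{(m)} = 1 + ∑_{k=1}^{m} ε^k n_±^{(k)}(ε^{1/2} (x - c t), ε^{3/2} t)`. -/
def truncatedDensity (c ε : ℝ) (m : ℕ) (n : ℕ → ℝ → ℝ → ℝ) : ℝ → ℝ → ℝ := fun x t =>
  1 + truncated c ε m n x t

/-- `-ε^{1-m} [∂_t N + ∂_x (N V)]`. -/
def densityResidual (ε : ℝ) (m : ℕ) (N V : ℝ → ℝ → ℝ) : ℝ → ℝ → ℝ := fun x t =>
  -ε ^ (1 - (m : ℤ)) * (dTime N x t + dSpace (fun x t => N x t * V x t) x t)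

/-- `-ε^{1-m} [μ (∂_t V + ½ ∂_x V²) + θ ∑_{k=1}^{m} (-1)^{k+1}/k ∂_x (N - 1)^k + σ ∂_x Φ]` for a
species of mass `μ`, temperature `θ` and charge `σ`. -/
def velocityResidual (μ θ σ ε : ℝ) (m : ℕ) (N V Φ : ℝ → ℝ → ℝ) : ℝ → ℝ → ℝ := fun x t =>
  -ε ^ (1 - (m : ℤ)) *
    (μ * (dTime V x t + 1 / 2 * dSpace (fun x t => V x t ^ 2) x t)
      + θ * ∑ k ∈ Finset.Icc 1 m,
          ((-1 : ℝ) ^ (k + 1) / k) * dSpace (fun x t => (N x t - 1) ^ k) x t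
      + σ * dSpace Φ x t)

/-- `-ε^{1-m} [∂_x² Φ - N_- + N_+]`. -/
def poissonResidual (ε : ℝ) (m : ℕ) (NP NM Φ : ℝ → ℝ → ℝ) : ℝ → ℝ → ℝ := fun x t =>
  -ε ^ (1 - (m : ℤ)) * (dSpace (dSpace Φ) x t - NM x t + NP x t)

/-- `sup_{t ≥ 0} ‖r(·, t)‖_{L²(x)} ≤ B`, where each `r(·, t)` is a genuine `L²` function. -/
def UniformL2Bound (r : ℝ → ℝ → ℝ) (B : ℝ) : Prop :=
  (∀ t, 0 ≤ t → MemLp (fun x => r x t) 2 volume) ∧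
    (⨆ t ∈ Set.Ici (0 : ℝ), eLpNorm (fun x => r x t) 2 volume) ≤ ENNReal.ofReal B

end EulerPoisson

end

/-!
In the moving frame `Y = ε^{1/2} (x - c t)`, `T = ε^{3/2} t` one has `∂_x = ε^{1/2} ∂_Y` and
`∂_t = ε^{1/2} (-c ∂_Y + ε ∂_T)`, so each bracket in a residual is, up to a factor `ε^{1/2}` in the
density and velocity residuals, a polynomial in `ε` whose coefficients are functions of `(Y, T)`. Its
coefficients of order at most `m` are the left sides of the hierarchy and vanish; for the velocities
this uses that `ℓ^{(K)}` is the coefficient of order `K ≤ m` of the truncated logarithm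
(`coeff_expansion_pow`, `sum_coeff_pow_eq_ell`). What remains is `ε^{m+1}` times a function bounded
in `L²(Y)`. The normalization gives `ε^{1-m}` and the passage from `L²(Y)` to `L²(x)` gives
`ε^{-1/4}` (`eLpNorm_dilation_le`), which leads to `ε^{2 - 1/4} = ε^{7/4}` for the Poisson residual
and to `ε^{9/4}` for the others.

The analytic content is that the remaining coefficients are bounded in `L²(Y)` and that the chain
rule applies. The Sobolev embedding (`exists_derivsBounded_of_chain`) turns the `H^s` bounds into
bounds on classical space derivatives. The remaining coefficients contain the time derivatives of
the profiles of level `m`, to which the evolution equations do not apply: for `n_+` they are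
computed from the KdV equations, and for `n_-`, `v_±` from the slaving relations, where
time derivatives of space derivatives appear. That the two kinds of derivative commute, and that the
profiles are differentiable along the moving frame, follows from differentiability in time at each
point together with the uniform bounds on second space derivatives
(`dSpace_mem_continuousFamilies`, `dSpace_mem_differentiableFamilies`,
`hasDerivWithinAt_moving_frame`).

Constants independent of the solution are obtained by treating all solutions below a given bound
at once, as the index set of families of functions. Families with uniform bounds form non-unital
algebras (`uniformFamilies`, `continuousFamilies`, `differentiableFamilies`), hence are stable under
the differential polynomials without constant term that occur in the relations (`evalJet_mem`).
-/

namespace EulerPoisson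

/-! ### Weak derivatives and the Sobolev embedding on the line -/

lemma intervalIntegrable_of_locallyIntegrable {w : ℝ → ℝ} (hw : LocallyIntegrable w)
    (a b : ℝ) : IntervalIntegrable w volume a b :=
  (hw.integrableOn_isCompact isCompact_uIcc).intervalIntegrable

lemma exists_forall_le_abs_eq_zero {θ : ℝ → ℝ} (hθ : HasCompactSupport θ) :
    ∃ r : ℝ, 0 < r ∧ ∀ y, r ≤ |y| → θ y = 0 := by
  obtain ⟨r, hr⟩ := hθ.isCompact.isBounded.subset_ball (0 : ℝ)
  refine ⟨max r 1, by positivity, fun y hy => ?_⟩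
  by_contra h
  have := hr (subset_tsupport _ h)
  rw [Metric.mem_ball, Real.dist_eq, sub_zero] at this
  exact absurd (lt_of_lt_of_le this (le_max_left r 1)) (not_lt.mpr hy)

/-- A locally integrable function with zero weak derivative is constant: a test function is the
derivative of another one up to a multiple of a fixed bump. -/
lemma ae_eq_const_of_weakDeriv_zero {v : ℝ → ℝ} (hv : LocallyIntegrable v)
    (h : ∀ θ : ℝ → ℝ, ContDiff ℝ (⊤ : ℕ∞) θ → HasCompactSupport θ →
      ∫ y, v y * deriv θ y = 0) :
    ∃ c : ℝ, ∀ᵐ y, v y = c := by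
  let ρ₀ : ContDiffBump (0 : ℝ) := ⟨1, 2, one_pos, one_lt_two⟩
  let ρ : ℝ → ℝ := ρ₀.normed volume
  have hρ : ContDiff ℝ (⊤ : ℕ∞) ρ := ρ₀.contDiff_normed
  have hρc : HasCompactSupport ρ := ρ₀.hasCompactSupport_normed
  have hρi : ∫ y, ρ y = 1 := ρ₀.integral_normed
  refine ⟨∫ y, ρ y * v y, ?_⟩
  refine ae_eq_of_integral_contDiff_smul_eq hv (locallyIntegrable_const _) fun θ hθ hθc => ?_
  set I := ∫ y, θ y with hI
  let ψ : ℝ → ℝ := fun y => θ y - I * ρ y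
  have hψ : ContDiff ℝ (⊤ : ℕ∞) ψ := hθ.sub (contDiff_const.mul hρ)
  have hψc : HasCompactSupport ψ := hθc.sub (hρc.mul_left (f := fun _ => I))
  have hθI : Integrable θ := hθ.continuous.integrable_of_hasCompactSupport hθc
  have hρI : Integrable ρ := hρ.continuous.integrable_of_hasCompactSupport hρc
  have hψ0 : ∫ y, ψ y = 0 := by
    simp only [ψ]
    rw [integral_sub hθI (hρI.const_mul I), integral_const_mul, hρi, ← hI]; ring
  obtain ⟨r, hr, hr0⟩ := exists_forall_le_abs_eq_zero hψc
  -- `ψ = θ - I ρ` has integral zero, so its primitive `Θ` has compact support.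
  let Θ : ℝ → ℝ := fun y => ∫ t in (-r)..y, ψ t
  have hΘd : ∀ y, HasDerivAt Θ (ψ y) y := fun y => hψ.continuous.integral_hasStrictDerivAt _ _
    |>.hasDerivAt
  have hΘ' : deriv Θ = ψ := funext fun y => (hΘd y).deriv
  have hΘ : ContDiff ℝ (⊤ : ℕ∞) Θ := by
    rw [contDiff_infty_iff_deriv, hΘ']
    exact ⟨fun y => (hΘd y).differentiableAt, hψ⟩
  have hfull : ∫ t in (-r)..r, ψ t = 0 := by
    rw [intervalIntegral.integral_eq_integral_of_support_subset, hψ0]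
    intro y hy
    have : ¬ r ≤ |y| := fun h' => hy (hr0 y h')
    rw [not_le, abs_lt] at this
    exact ⟨this.1, this.2.le⟩
  have hΘc : HasCompactSupport Θ := by
    refine HasCompactSupport.intro (isCompact_Icc (a := -r) (b := r)) fun y hy => ?_
    have hz : ∀ a b : ℝ, (∀ t ∈ Set.uIcc a b, r ≤ |t|) → ∫ t in a..b, ψ t = 0 := by
      intro a b hab
      rw [intervalIntegral.integral_congr (g := fun _ => 0) (fun t ht => hr0 t (hab t ht))]
      simp
    rw [Set.mem_Icc, not_and_or, not_le, not_le] at hy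
    rcases hy with hy | hy
    · apply hz
      intro t ht
      rw [Set.uIcc_of_ge hy.le] at ht
      exact le_abs.mpr (Or.inr (by linarith [ht.2]))
    · have : Θ y = (∫ t in (-r)..r, ψ t) + ∫ t in r..y, ψ t :=
        (intervalIntegral.integral_add_adjacent_intervals
          (hψ.continuous.intervalIntegrable _ _) (hψ.continuous.intervalIntegrable _ _)).symm
      rw [this, hfull, zero_add]
      apply hz
      intro t ht
      rw [Set.uIcc_of_le hy.le] at ht
      exact le_abs.mpr (Or.inl ht.1)
  have key := h Θ hΘ hΘc
  rw [hΘ'] at key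
  have h1 : Integrable fun y => θ y * v y :=
    hv.integrable_smul_left_of_hasCompactSupport hθ.continuous hθc
  have h2 : Integrable fun y => ρ y * v y :=
    hv.integrable_smul_left_of_hasCompactSupport hρ.continuous hρc
  have h3 : ∫ y, v y * ψ y = (∫ y, θ y * v y) - I * ∫ y, ρ y * v y := by
    rw [← integral_const_mul, ← integral_sub h1 (h2.const_mul I)]
    congr 1; ext y; simp only [ψ]; ring
  simp only [smul_eq_mul]
  rw [integral_mul_const, ← hI]
  linarith [h3, key]

/-- A primitive of a locally integrable function has it as weak derivative. -/
lemma integral_primitive_mul_deriv {w : ℝ → ℝ} (hw : LocallyIntegrable w) {θ : ℝ → ℝ}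
    (hθ : ContDiff ℝ (⊤ : ℕ∞) θ) (hθc : HasCompactSupport θ) :
    ∫ y, (∫ t in (0 : ℝ)..y, w t) * deriv θ y = -∫ y, w y * θ y := by
  obtain ⟨r, hr, hr0⟩ := exists_forall_le_abs_eq_zero hθc
  obtain ⟨r', -, hr0'⟩ := exists_forall_le_abs_eq_zero hθc.deriv
  set q := max r r' with hq
  have hq0 : 0 < q := lt_of_lt_of_le hr (le_max_left _ _)
  have hsupp : ∀ f : ℝ → ℝ, (∀ y, q ≤ |y| → f y = 0) →
      ∫ y, f y = ∫ y in (-q)..q, f y := by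
    intro f hf
    rw [intervalIntegral.integral_eq_integral_of_support_subset]
    intro y hy
    have : ¬ q ≤ |y| := fun h' => hy (hf y h')
    rw [not_le, abs_lt] at this
    exact ⟨this.1, this.2.le⟩
  have hwI : IntervalIntegrable w volume (-q) q :=
    intervalIntegrable_of_locallyIntegrable hw _ _
  have h0 : (0 : ℝ) ∈ Set.uIcc (-q) q := by
    rw [Set.uIcc_of_le (by linarith)]; exact ⟨by linarith, hq0.le⟩
  have hW := hwI.absolutelyContinuousOnInterval_intervalIntegral h0
  have hθA : AbsolutelyContinuousOnInterval θ (-q) q :=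
    (hθ.of_le (by exact_mod_cast le_top)).contDiffOn.absolutelyContinuousOnInterval
  rw [hsupp _ fun y hy => by rw [hr0' y ((le_max_right _ _).trans hy), mul_zero],
    hsupp _ fun y hy => by rw [hr0 y ((le_max_left _ _).trans hy), mul_zero],
    hW.integral_mul_deriv_eq_deriv_mul hθA,
    hr0 q ((le_max_left _ _).trans (le_abs_self q)),
    hr0 (-q) ((le_max_left _ _).trans ((le_abs_self q).trans_eq (abs_neg q).symm))]
  have : ∫ x in (-q)..q, deriv (fun y => ∫ t in (0 : ℝ)..y, w t) x * θ x =
      ∫ x in (-q)..q, w x * θ x := by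
    apply intervalIntegral.integral_congr_ae
    filter_upwards [hwI.ae_hasDerivAt_integral] with x hx hxI
    rw [(hx (Set.uIoc_subset_uIcc hxI) 0 h0).deriv]
  rw [this]; ring

/-- A function with a weak derivative is, almost everywhere, a primitive of it. -/
lemma HasWeakDeriv.ae_eq_primitive {u w : ℝ → ℝ} (h : HasWeakDeriv u w) :
    ∃ c : ℝ, ∀ᵐ y, u y = c + ∫ t in (0 : ℝ)..y, w t := by
  obtain ⟨hu, hw, hθ⟩ := h
  have hWc : Continuous fun y => ∫ t in (0 : ℝ)..y, w t :=
    intervalIntegral.continuous_primitive (intervalIntegrable_of_locallyIntegrable hw) 0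
  obtain ⟨c, hc⟩ := ae_eq_const_of_weakDeriv_zero
    (v := fun y => u y - ∫ t in (0 : ℝ)..y, w t) (hu.sub hWc.locallyIntegrable) (by
      intro θ h1 h2
      have hd : Continuous (deriv θ) := h1.continuous_deriv (by simp)
      have i1 : Integrable fun y => deriv θ y * u y :=
        hu.integrable_smul_left_of_hasCompactSupport hd h2.deriv
      have i2 : Integrable fun y => deriv θ y * ∫ t in (0 : ℝ)..y, w t :=
        hWc.locallyIntegrable.integrable_smul_left_of_hasCompactSupport hd h2.deriv
      have : ∫ y, (u y - ∫ t in (0 : ℝ)..y, w t) * deriv θ y =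
          (∫ y, u y * deriv θ y) - ∫ y, (∫ t in (0 : ℝ)..y, w t) * deriv θ y := by
        rw [← integral_sub]
        · congr 1; ext y; ring
        · simpa only [mul_comm] using i1
        · simpa only [mul_comm] using i2
      rw [this, hθ θ h1 h2, integral_primitive_mul_deriv hw h1 h2, sub_self])
  exact ⟨c, hc.mono fun y hy => by linarith⟩

/-- `f` is continuous and its sup and `L²` norms are at most `B`. -/
def BoundedL2 (B : ℝ≥0) (f : ℝ → ℝ) : Prop :=
  Continuous f ∧ (∀ y, |f y| ≤ B) ∧ eLpNorm f 2 volume ≤ B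

/-- `f` has `r` classical derivatives, and `f` and all of them have sup and `L²` norm at most
`B`. -/
def DerivsBounded (B : ℝ≥0) : ℕ → (ℝ → ℝ) → Prop
  | 0, f => BoundedL2 B f
  | r + 1, f => BoundedL2 B f ∧ Differentiable ℝ f ∧ DerivsBounded B r (deriv f)

/-- On an interval of length one, the `L¹` norm is at most the `L²` norm. -/
lemma setIntegral_abs_le_of_eLpNorm_le {f : ℝ → ℝ} (hf : MemLp f 2 volume) {B : ℝ≥0}
    (hB : eLpNorm f 2 volume ≤ B) (y : ℝ) :
    IntegrableOn (fun z => |f z|) (Set.Ioc y (y + 1)) ∧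
      ∫ z in Set.Ioc y (y + 1), |f z| ≤ B := by
  set μ := (volume : Measure ℝ).restrict (Set.Ioc y (y + 1))
  have : IsProbabilityMeasure μ := ⟨by simp [μ]⟩
  have hfμ : MemLp f 2 μ := hf.restrict _
  have h1 : MemLp f 1 μ := hfμ.mono_exponent (by norm_num)
  have hle : eLpNorm f 1 μ ≤ B :=
    (eLpNorm_le_eLpNorm_of_exponent_le (by norm_num) hfμ.1).trans
      ((eLpNorm_mono_measure f Measure.restrict_le_self).trans hB)
  have hi : Integrable f μ := memLp_one_iff_integrable.mp h1
  refine ⟨hi.abs, ?_⟩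
  have : ∫ z, |f z| ∂μ = (eLpNorm f 1 μ).toReal := by
    rw [eLpNorm_one_eq_lintegral_enorm, ← integral_norm_eq_lintegral_enorm hi.1]; rfl
  change ∫ z, |f z| ∂μ ≤ B
  rw [this]
  exact ENNReal.toReal_le_coe_of_le_coe hle

/-- The embedding `H¹(ℝ) ⊆ L^∞(ℝ)` for primitives. -/
lemma abs_le_of_primitive {g w : ℝ → ℝ} {c : ℝ} {B : ℝ≥0} (hw : MemLp w 2 volume)
    (hg : MemLp g 2 volume) (hwB : eLpNorm w 2 volume ≤ B) (hgB : eLpNorm g 2 volume ≤ B)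
    (h : ∀ y, g y = c + ∫ t in (0 : ℝ)..y, w t) (y : ℝ) : |g y| ≤ 2 * B := by
  have hwl : ∀ a b, IntervalIntegrable w volume a b := 
    intervalIntegrable_of_locallyIntegrable (hw.locallyIntegrable (by norm_num))
  obtain ⟨iw, bw⟩ := setIntegral_abs_le_of_eLpNorm_le hw hwB y
  obtain ⟨ig, bg⟩ := setIntegral_abs_le_of_eLpNorm_le hg hgB y
  have hz : ∀ z ∈ Set.Ioc y (y + 1), |g y| ≤ |g z| + B := by
    intro z hz
    have e : g y = g z - ∫ t in y..z, w t := by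
      rw [h y, h z, ← intervalIntegral.integral_add_adjacent_intervals (hwl 0 y) (hwl y z)]
      ring
    have b : |∫ t in y..z, w t| ≤ B := by
      refine (intervalIntegral.abs_integral_le_integral_abs hz.1.le).trans (le_trans ?_ bw)
      rw [intervalIntegral.integral_of_le hz.1.le]
      exact setIntegral_mono_set iw (Filter.Eventually.of_forall fun t => abs_nonneg _)
        (Set.Ioc_subset_Ioc_right hz.2).eventuallyLE
    rw [e]
    exact (abs_sub _ _).trans (by linarith)
  have h1 : ∫ _ in Set.Ioc y (y + 1), |g y| ≤ ∫ z in Set.Ioc y (y + 1), (|g z| + B) :=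
    setIntegral_mono_on (by simp) (ig.add (by simp)) measurableSet_Ioc hz
  rw [integral_add ig (by simp)] at h1
  simp at h1
  linarith

lemma BoundedL2.of_primitive {u g w : ℝ → ℝ} {c : ℝ} {B : ℝ≥0} (hw : MemLp w 2 volume)
    (hu : MemLp u 2 volume) (hwB : eLpNorm w 2 volume ≤ B) (huB : eLpNorm u 2 volume ≤ B)
    (hug : u =ᵐ[volume] g) (h : ∀ y, g y = c + ∫ t in (0 : ℝ)..y, w t) :
    BoundedL2 (2 * B) g := by
  have hg : MemLp g 2 volume := hu.ae_eq hug
  have hgB : eLpNorm g 2 volume ≤ B := (eLpNorm_congr_ae hug).symm.trans_le huB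
  refine ⟨?_, fun y => by simpa using abs_le_of_primitive hw hg hwB hgB h y,
    hgB.trans (by exact_mod_cast le_mul_of_one_le_left' one_le_two)⟩
  rw [funext h]
  exact continuous_const.add (intervalIntegral.continuous_primitive
    (intervalIntegrable_of_locallyIntegrable (hw.locallyIntegrable (by norm_num))) 0)

/-- The Sobolev embedding `H^{r+1}(ℝ) ⊆ C^r(ℝ)`, with control of all derivatives. -/
lemma exists_derivsBounded_of_chain (B : ℝ≥0) (r : ℕ) (w : ℕ → ℝ → ℝ)
    (hw : ∀ i ≤ r + 1, MemLp (w i) 2 volume) (hB : ∀ i ≤ r + 1, eLpNorm (w i) 2 volume ≤ B)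
    (hd : ∀ i < r + 1, HasWeakDeriv (w i) (w (i + 1))) :
    ∃ g : ℝ → ℝ, w 0 =ᵐ[volume] g ∧ DerivsBounded (2 * B) r g := by
  induction r generalizing w with
  | zero =>
    obtain ⟨c, hc⟩ := (hd 0 (by omega)).ae_eq_primitive
    exact ⟨_, hc, BoundedL2.of_primitive (hw 1 (by omega)) (hw 0 (by omega)) (hB 1 (by omega))
      (hB 0 (by omega)) hc fun y => rfl⟩
  | succ r ih =>
    obtain ⟨g₁, hg₁, hb⟩ := ih (fun i => w (i + 1)) (fun i hi => hw _ (by omega))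
      (fun i hi => hB _ (by omega)) (fun i hi => hd _ (by omega))
    obtain ⟨c, hc⟩ := (hd 0 (by omega)).ae_eq_primitive
    have hg₁c : Continuous g₁ := by
      cases r with
      | zero => exact hb.1
      | succ r => exact hb.1.1
    -- The weak derivative may be replaced by its continuous representative, so that the primitive
    -- is continuously differentiable.
    have hder : ∀ y, HasDerivAt (fun y => c + ∫ t in (0 : ℝ)..y, w 1 t) (g₁ y) y := by
      intro y
      have : (fun y => c + ∫ t in (0 : ℝ)..y, w 1 t) = fun y => c + ∫ t in (0 : ℝ)..y, g₁ t := by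
        funext y
        rw [intervalIntegral.integral_congr_ae (hg₁.mono fun t ht _ => ht)]
      rw [this]
      exact (hg₁c.integral_hasStrictDerivAt 0 y).hasDerivAt.const_add c
    refine ⟨_, hc, BoundedL2.of_primitive (hw 1 (by omega)) (hw 0 (by omega)) (hB 1 (by omega))
      (hB 0 (by omega)) hc fun y => rfl, fun y => (hder y).differentiableAt, ?_⟩
    rw [show deriv (fun y => c + ∫ t in (0 : ℝ)..y, w 1 t) = g₁ from
      funext fun y => (hder y).deriv]
    exact hb

/-- The chain of weak derivatives that nearly attains the infimum in `hsNorm` represents classical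
derivatives of a continuous function. The `+ 1` makes room for an infimum that is not attained. -/
lemma derivsBounded_of_hsNorm_le {r s : ℕ} (hrs : r + 1 ≤ s) {M : ℝ≥0} {u : ℝ → ℝ}
    (hu : Continuous u) (h : hsNorm s u ≤ M) : DerivsBounded (2 * (M + 1)) r u := by
  have hlt : hsNorm s u < ((M + 1 : ℝ≥0) : ℝ≥0∞) :=
    h.trans_lt (by exact_mod_cast lt_add_one M)
  rw [hsNorm, iInf_lt_iff] at hlt
  obtain ⟨w, hw⟩ := hlt
  rw [iInf_lt_iff] at hw
  obtain ⟨⟨h0, hL, hd⟩, hlt⟩ := hw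
  have hB : ∀ i ≤ s, eLpNorm (w i) 2 volume ≤ ((M + 1 : ℝ≥0) : ℝ≥0∞) := by
    intro i hi
    refine le_trans ?_ hlt.le
    have : eLpNorm (w i) 2 volume = (eLpNorm (w i) 2 volume ^ (2 : ℝ)) ^ (1 / 2 : ℝ) := by
      rw [← ENNReal.rpow_mul]; norm_num
    rw [this]
    refine ENNReal.rpow_le_rpow ?_ (by norm_num)
    exact Finset.single_le_sum (f := fun i => eLpNorm (w i) 2 volume ^ (2 : ℝ))
      (fun _ _ => zero_le) (Finset.mem_range.mpr (by omega))
  obtain ⟨g, hg, hb⟩ := exists_derivsBounded_of_chain (M + 1) r w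
    (fun i hi => hL i (by omega)) (fun i hi => hB i (by omega)) (fun i hi => hd i (by omega))
  have hgc : Continuous g := by
    cases r with
    | zero => exact hb.1
    | succ r => exact hb.1.1
  rw [h0] at hg
  rwa [(hu.ae_eq_iff_eq volume hgc).mp hg]

end EulerPoisson

namespace EulerPoisson

/-! ### Uniform families of functions of the space variable -/

lemma BoundedL2.mono {A B : ℝ≥0} (h : A ≤ B) {f : ℝ → ℝ} (hf : BoundedL2 A f) :
    BoundedL2 B f :=
  ⟨hf.1, fun y => (hf.2.1 y).trans (by exact_mod_cast h), hf.2.2.trans (by exact_mod_cast h)⟩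

lemma BoundedL2.memLp {B : ℝ≥0} {f : ℝ → ℝ} (hf : BoundedL2 B f) : MemLp f 2 volume :=
  ⟨hf.1.aestronglyMeasurable, hf.2.2.trans_lt ENNReal.coe_lt_top⟩

lemma BoundedL2.add {A B : ℝ≥0} {f g : ℝ → ℝ} (hf : BoundedL2 A f) (hg : BoundedL2 B g) :
    BoundedL2 (A + B) (f + g) := by
  refine ⟨hf.1.add hg.1, fun y => ?_, ?_⟩
  · push_cast
    exact (abs_add_le _ _).trans (add_le_add (hf.2.1 y) (hg.2.1 y))
  · push_cast
    exact (eLpNorm_add_le hf.memLp.1 hg.memLp.1 (by norm_num)).trans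
      (add_le_add hf.2.2 hg.2.2)

lemma BoundedL2.const_smul {B : ℝ≥0} {f : ℝ → ℝ} (hf : BoundedL2 B f) (c : ℝ) :
    BoundedL2 (‖c‖₊ * B) (c • f) := by
  refine ⟨hf.1.const_smul c, fun y => ?_, ?_⟩
  · rw [Pi.smul_apply, smul_eq_mul, abs_mul]
    push_cast
    exact mul_le_mul_of_nonneg_left (hf.2.1 y) (abs_nonneg c)
  · rw [eLpNorm_const_smul, ENNReal.coe_mul]
    exact mul_le_mul_right hf.2.2 _

lemma BoundedL2.mul {A B : ℝ≥0} {f g : ℝ → ℝ} (hf : BoundedL2 A f) (hg : BoundedL2 B g) :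
    BoundedL2 (A * B) (f * g) := by
  refine ⟨hf.1.mul hg.1, fun y => ?_, ?_⟩
  · rw [Pi.mul_apply, abs_mul]
    push_cast
    exact mul_le_mul (hf.2.1 y) (hg.2.1 y) (abs_nonneg _) A.2
  · have h := eLpNorm_le_nnreal_smul_eLpNorm_of_ae_le_mul (f := f * g) (g := g) (c := A)
      (μ := volume) (Filter.Eventually.of_forall fun y => by
        rw [Pi.mul_apply, nnnorm_mul]
        exact mul_le_mul_of_nonneg_right (hf.2.1 y) (norm_nonneg _)) 2
    rw [ENNReal.coe_mul]
    exact h.trans (mul_le_mul_right hg.2.2 _)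

lemma DerivsBounded.mono {A B : ℝ≥0} (h : A ≤ B) {r : ℕ} {f : ℝ → ℝ}
    (hf : DerivsBounded A r f) : DerivsBounded B r f := by
  induction r generalizing f with
  | zero => exact BoundedL2.mono h hf
  | succ r ih => exact ⟨hf.1.mono h, hf.2.1, ih hf.2.2⟩

lemma DerivsBounded.of_succ {B : ℝ≥0} {r : ℕ} {f : ℝ → ℝ} (hf : DerivsBounded B (r + 1) f) :
    DerivsBounded B r f := by
  induction r generalizing f with
  | zero => exact hf.1
  | succ r ih => exact ⟨hf.1, hf.2.1, ih hf.2.2⟩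

lemma DerivsBounded.of_le {B : ℝ≥0} {r r' : ℕ} (h : r ≤ r') {f : ℝ → ℝ}
    (hf : DerivsBounded B r' f) : DerivsBounded B r f := by
  induction h with
  | refl => exact hf
  | step _ ih => exact ih hf.of_succ

lemma DerivsBounded.zero (r : ℕ) : DerivsBounded 0 r 0 := by
  have h0 : BoundedL2 0 0 := ⟨continuous_const, fun y => by simp, by simp⟩
  induction r with
  | zero => exact h0
  | succ r ih =>
    refine ⟨h0, differentiable_const _, ?_⟩
    rwa [show deriv (0 : ℝ → ℝ) = 0 from funext fun y => deriv_const y 0]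

lemma DerivsBounded.add {A B : ℝ≥0} {r : ℕ} {f g : ℝ → ℝ} (hf : DerivsBounded A r f)
    (hg : DerivsBounded B r g) : DerivsBounded (A + B) r (f + g) := by
  induction r generalizing f g with
  | zero => exact BoundedL2.add hf hg
  | succ r ih =>
    refine ⟨hf.1.add hg.1, hf.2.1.add hg.2.1, ?_⟩
    rw [show deriv (f + g) = deriv f + deriv g from
      funext fun y => deriv_add (hf.2.1 y) (hg.2.1 y)]
    exact ih hf.2.2 hg.2.2

lemma DerivsBounded.const_smul {B : ℝ≥0} {r : ℕ} {f : ℝ → ℝ} (hf : DerivsBounded B r f)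
    (c : ℝ) : DerivsBounded (‖c‖₊ * B) r (c • f) := by
  induction r generalizing f with
  | zero => exact BoundedL2.const_smul hf c
  | succ r ih =>
    refine ⟨hf.1.const_smul c, hf.2.1.const_smul c, ?_⟩
    rw [show deriv (c • f) = c • deriv f from funext fun y => deriv_const_smul c (hf.2.1 y)]
    exact ih hf.2.2

lemma DerivsBounded.mul {A B : ℝ≥0} {r : ℕ} {f g : ℝ → ℝ} (hf : DerivsBounded A r f)
    (hg : DerivsBounded B r g) : DerivsBounded (2 ^ r * (A * B)) r (f * g) := by
  induction r generalizing f g with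
  | zero => rw [pow_zero, one_mul]; exact BoundedL2.mul hf hg
  | succ r ih =>
    refine ⟨(hf.1.mul hg.1).mono (le_mul_of_one_le_left' (one_le_pow₀ one_le_two)),
      hf.2.1.mul hg.2.1, ?_⟩
    rw [show deriv (f * g) = deriv f * g + f * deriv g from
      funext fun y => deriv_mul (hf.2.1 y) (hg.2.1 y)]
    refine ((ih hf.2.2 hg.of_succ).add (ih hf.of_succ hg.2.2)).mono (le_of_eq ?_)
    ring

/-- The families of functions on `ℝ`, indexed by `ι`, that are bounded in `W^{r,∞} ∩ H^r` uniformly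
in the index. Not unital, since nonzero constants are not in `L²`. -/
def uniformFamilies (ι : Type*) (r : ℕ) : NonUnitalSubalgebra ℝ (ι → ℝ → ℝ) where
  carrier := {u | ∃ B : ℝ≥0, ∀ i, DerivsBounded B r (u i)}
  zero_mem' := ⟨0, fun _ => DerivsBounded.zero r⟩
  add_mem' := fun ⟨A, hA⟩ ⟨B, hB⟩ => ⟨A + B, fun i => (hA i).add (hB i)⟩
  mul_mem' := fun ⟨A, hA⟩ ⟨B, hB⟩ => ⟨2 ^ r * (A * B), fun i => (hA i).mul (hB i)⟩
  smul_mem' := fun c _ ⟨B, hB⟩ => ⟨‖c‖₊ * B, fun i => (hB i).const_smul c⟩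

lemma uniformFamilies_of_le {ι : Type*} {r r' : ℕ} (h : r ≤ r') :
    uniformFamilies ι r' ≤ uniformFamilies ι r :=
  fun _ ⟨B, hB⟩ => ⟨B, fun i => (hB i).of_le h⟩

lemma deriv_mem_uniformFamilies {ι : Type*} {r : ℕ} {u : ι → ℝ → ℝ}
    (hu : u ∈ uniformFamilies ι (r + 1)) : (fun i => deriv (u i)) ∈ uniformFamilies ι r :=
  let ⟨B, hB⟩ := hu; ⟨B, fun i => (hB i).2.2⟩

/-- Taylor's formula with the uniform bound on the second derivative. -/
lemma DerivsBounded.abs_taylor_le {B : ℝ≥0} {f : ℝ → ℝ} (hf : DerivsBounded B 2 f) (y z : ℝ) :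
    |f z - f y - (z - y) * deriv f y| ≤ B * (z - y) ^ 2 := by
  obtain ⟨-, hd, -, hd2, h2⟩ := hf
  have hlip : ∀ w, |deriv f w - deriv f y| ≤ B * |w - y| := fun w =>
    Convex.norm_image_sub_le_of_norm_deriv_le (s := Set.univ) (fun x _ => hd2 x)
      (fun x _ => h2.2.1 x) convex_univ trivial trivial
  have hder : ∀ w ∈ Set.uIcc y z, HasDerivWithinAt (fun w => f w - w * deriv f y)
      (deriv f w - deriv f y) (Set.uIcc y z) w := fun w _ => by
    have := ((hd w).hasDerivAt.sub ((hasDerivAt_id w).mul_const (deriv f y))).hasDerivWithinAt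
      (s := Set.uIcc y z)
    rw [one_mul] at this
    exact this
  have h := Convex.norm_image_sub_le_of_norm_hasDerivWithin_le (C := B * |z - y|) hder
    (fun w hw => (hlip w).trans (mul_le_mul_of_nonneg_left
      (Set.abs_sub_left_of_mem_uIcc hw) B.2)) (convex_uIcc y z) Set.left_mem_uIcc
    Set.right_mem_uIcc
  simp only [Real.norm_eq_abs] at h
  rw [mul_assoc, abs_mul_abs_self] at h
  refine le_trans (le_of_eq ?_) (h.trans_eq (by ring))
  congr 1; ring

/-! ### Uniform families of functions of space and time -/

/-- The space-time families, indexed by `κ`, whose time slices for `T ≥ 0` form a uniform family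
with `r` space derivatives, and which are continuous in time at each point. -/
def continuousFamilies (κ : Type*) (r : ℕ) : NonUnitalSubalgebra ℝ (κ → ℝ → ℝ → ℝ) where
  carrier := {a | (fun (i : κ × ℝ≥0) y => a i.1 y i.2) ∈ uniformFamilies (κ × ℝ≥0) r ∧
    ∀ k y, ContinuousOn (a k y) (Set.Ici 0)}
  zero_mem' := ⟨zero_mem (uniformFamilies _ r), fun _ _ => continuousOn_const⟩
  add_mem' := fun ha hb => ⟨add_mem ha.1 hb.1, fun k y => (ha.2 k y).add (hb.2 k y)⟩
  mul_mem' := fun ha hb => ⟨mul_mem ha.1 hb.1, fun k y => (ha.2 k y).mul (hb.2 k y)⟩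
  smul_mem' := fun c _ ha => ⟨SMulMemClass.smul_mem c ha.1, fun k y => (ha.2 k y).const_smul c⟩

/-- The members of `continuousFamilies κ r` with a time derivative in `continuousFamilies κ r`. -/
def differentiableFamilies (κ : Type*) (r : ℕ) : NonUnitalSubalgebra ℝ (κ → ℝ → ℝ → ℝ) where
  carrier := {a | a ∈ continuousFamilies κ r ∧ ∃ b ∈ continuousFamilies κ r,
    ∀ k y, ∀ T, 0 ≤ T → HasDerivWithinAt (a k y) (b k y T) (Set.Ici 0) T}
  zero_mem' := ⟨zero_mem _, 0, zero_mem _, fun _ _ T _ => hasDerivWithinAt_const T _ 0⟩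
  add_mem' := fun ⟨ha, a', ha', hda⟩ ⟨hb, b', hb', hdb⟩ => ⟨add_mem ha hb, a' + b',
    add_mem ha' hb', fun k y T hT => (hda k y T hT).add (hdb k y T hT)⟩
  mul_mem' := fun {a b} ⟨ha, a', ha', hda⟩ ⟨hb, b', hb', hdb⟩ => ⟨mul_mem ha hb,
    a' * b + a * b', add_mem (mul_mem ha' hb) (mul_mem ha hb'),
    fun k y T hT => (hda k y T hT).mul (hdb k y T hT)⟩
  smul_mem' := fun c _ ⟨ha, a', ha', hda⟩ => ⟨SMulMemClass.smul_mem c ha, c • a',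
    SMulMemClass.smul_mem c ha', fun k y T hT => (hda k y T hT).const_smul c⟩

variable {κ : Type*}

lemma continuousFamilies_of_le {r r' : ℕ} (h : r ≤ r') :
    continuousFamilies κ r' ≤ continuousFamilies κ r :=
  fun _ ha => ⟨uniformFamilies_of_le h ha.1, ha.2⟩

lemma continuousFamilies_congr {r : ℕ} {a b : κ → ℝ → ℝ → ℝ}
    (h : ∀ k y T, 0 ≤ T → a k y T = b k y T) (hb : b ∈ continuousFamilies κ r) :
    a ∈ continuousFamilies κ r := by
  refine ⟨?_, fun k y => (hb.2 k y).congr fun T hT => h k y T hT⟩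
  convert hb.1 using 3
  exact h _ _ _ (NNReal.coe_nonneg _)

lemma differentiableFamilies_congr {r : ℕ} {a b : κ → ℝ → ℝ → ℝ}
    (h : ∀ k y T, 0 ≤ T → a k y T = b k y T) (hb : b ∈ differentiableFamilies κ r) :
    a ∈ differentiableFamilies κ r := by
  obtain ⟨hb, b', hb', hd⟩ := hb
  exact ⟨continuousFamilies_congr h hb, b', hb', fun k y T hT =>
    (hd k y T hT).congr (fun τ hτ => h k y τ hτ) (h k y T hT)⟩

lemma exists_derivsBounded_of_mem {r : ℕ} {a : κ → ℝ → ℝ → ℝ}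
    (ha : a ∈ continuousFamilies κ r) :
    ∃ B : ℝ≥0, ∀ k T, 0 ≤ T → DerivsBounded B r (fun y => a k y T) := by
  obtain ⟨⟨B, hB⟩, -⟩ := ha
  exact ⟨B, fun k T hT => hB (k, ⟨T, hT⟩)⟩

/-- Interpolation: continuity in time and a uniform bound on the second space derivative make the
first space derivative continuous in time, as a uniform limit of difference quotients. -/
lemma dSpace_mem_continuousFamilies {r : ℕ} (hr : 1 ≤ r) {a : κ → ℝ → ℝ → ℝ}
    (ha : a ∈ continuousFamilies κ (r + 1)) :
    (fun k => dSpace (a k)) ∈ continuousFamilies κ r := by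
  refine ⟨deriv_mem_uniformFamilies ha.1, fun k y => ?_⟩
  obtain ⟨B, hB⟩ := exists_derivsBounded_of_mem ha
  refine continuousOn_of_uniform_approx_of_continuousOn fun u hu => ?_
  obtain ⟨δ, hδ, hu⟩ := Metric.mem_uniformity_dist.mp hu
  -- The step `h` makes the Taylor error `B h` of the difference quotient smaller than `δ`.
  set h := δ / (2 * (B + 1)) with hh
  have hB1 : (0 : ℝ) < B + 1 := by positivity
  have hh0 : 0 < h := by positivity
  have hBh : B * h < δ := by
    have : (B + 1) * h = δ / 2 := by rw [hh]; field_simp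
    nlinarith
  refine ⟨fun T => (a k (y + h) T - a k y T) / h,
    ((ha.2 k (y + h)).sub (ha.2 k y)).div_const h, fun T hT => hu ?_⟩
  have := ((hB k T hT).of_le (by omega : 2 ≤ r + 1)).abs_taylor_le y (y + h)
  rw [add_sub_cancel_left] at this
  rw [dist_comm, Real.dist_eq]
  change |(a k (y + h) T - a k y T) / h - deriv (fun z => a k z T) y| < δ
  have e : (a k (y + h) T - a k y T) / h - deriv (fun z => a k z T) y =
      (a k (y + h) T - a k y T - h * deriv (fun z => a k z T) y) / h := by
    field_simp
  rw [e, abs_div, abs_of_pos hh0, div_lt_iff₀ hh0]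
  nlinarith

/-- Space and time derivatives commute: the mean value inequality in time is applied to a difference
quotient in space. -/
lemma dSpace_mem_differentiableFamilies {r : ℕ} (hr : 1 ≤ r) {a : κ → ℝ → ℝ → ℝ}
    (ha : a ∈ differentiableFamilies κ (r + 1)) :
    (fun k => dSpace (a k)) ∈ differentiableFamilies κ r := by
  obtain ⟨ha, b, hb, hd⟩ := ha
  have hb' := dSpace_mem_continuousFamilies hr hb
  refine ⟨dSpace_mem_continuousFamilies hr ha, _, hb', fun k y T hT => ?_⟩
  obtain ⟨A, hA⟩ := exists_derivsBounded_of_mem ha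
  obtain ⟨B, hB⟩ := exists_derivsBounded_of_mem hb
  have h2 : 2 ≤ r + 1 := by omega
  rw [hasDerivWithinAt_iff_isLittleO, Asymptotics.isLittleO_iff]
  intro δ hδ
  obtain ⟨η, hη, hball⟩ := Metric.continuousOn_iff.mp (hb'.2 k y) T hT (δ / 2) (by positivity)
  filter_upwards [inter_mem_nhdsWithin (Set.Ici 0) (Metric.ball_mem_nhds T hη)] with τ hτ
  set D := dSpace (b k) y T with hD
  set X := dSpace (a k) y τ - dSpace (a k) y T - (τ - T) • D with hX
  -- Up to the Taylor error, `X` is the increment of a difference quotient of step `h`, to which the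
  -- mean value inequality in time applies.
  have key : ∀ h : ℝ, 0 < h → B * h ≤ δ / 2 → |X| ≤ δ * |τ - T| + 2 * A * h := by
    intro h hh hBh
    have hder : ∀ q ∈ Set.Ici (0 : ℝ) ∩ Metric.ball T η,
        HasDerivWithinAt (fun q => a k (y + h) q - a k y q - q * (h * D))
          (b k (y + h) q - b k y q - h * D) (Set.Ici (0 : ℝ) ∩ Metric.ball T η) q := by
      intro q hq
      have := ((hd k (y + h) q hq.1).sub (hd k y q hq.1)).sub
        ((hasDerivWithinAt_id q (Set.Ici 0)).mul_const (h * D))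
      rw [one_mul] at this
      exact this.mono Set.inter_subset_left
    have hbound : ∀ q ∈ Set.Ici (0 : ℝ) ∩ Metric.ball T η,
        ‖b k (y + h) q - b k y q - h * D‖ ≤ h * δ := by
      intro q hq
      have t := ((hB k q hq.1).of_le h2).abs_taylor_le y (y + h)
      rw [add_sub_cancel_left] at t
      have c := (hball q hq.1 hq.2).le
      rw [Real.dist_eq] at c
      change |deriv (fun z => b k z q) y - D| ≤ δ / 2 at c
      have e : b k (y + h) q - b k y q - h * D =
          (b k (y + h) q - b k y q - h * deriv (fun z => b k z q) y) +
          h * (deriv (fun z => b k z q) y - D) := by ring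
      rw [Real.norm_eq_abs, e]
      refine (abs_add_le _ _).trans ?_
      rw [abs_mul, abs_of_pos hh]
      nlinarith
    have mv := Convex.norm_image_sub_le_of_norm_hasDerivWithin_le hder hbound
      ((convex_Ici 0).inter (convex_ball T η)) ⟨hT, Metric.mem_ball_self hη⟩ hτ
    simp only [Real.norm_eq_abs] at mv
    have t1 := ((hA k τ hτ.1).of_le h2).abs_taylor_le y (y + h)
    have t2 := ((hA k T hT).of_le h2).abs_taylor_le y (y + h)
    rw [add_sub_cancel_left] at t1 t2
    change |a k (y + h) τ - a k y τ - h * dSpace (a k) y τ| ≤ A * h ^ 2 at t1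
    change |a k (y + h) T - a k y T - h * dSpace (a k) y T| ≤ A * h ^ 2 at t2
    have e : h * X = (a k (y + h) τ - a k y τ - τ * (h * D) -
        (a k (y + h) T - a k y T - T * (h * D))) -
        (a k (y + h) τ - a k y τ - h * dSpace (a k) y τ) +
        (a k (y + h) T - a k y T - h * dSpace (a k) y T) := by
      rw [hX, smul_eq_mul]; ring
    have hle : h * |X| ≤ h * (δ * |τ - T| + 2 * A * h) := by
      rw [← abs_of_pos hh, ← abs_mul, abs_of_pos hh, e]
      refine (abs_add_le _ _).trans ((add_le_add_left (abs_sub _ _) _).trans ?_)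
      linarith
    exact le_of_mul_le_mul_left hle hh
  refine le_of_forall_pos_le_add fun ξ hξ => ?_
  have hA1 : (0 : ℝ) < A + 1 := by positivity
  have hB1 : (0 : ℝ) < B + 1 := by positivity
  set h := min (δ / (2 * (B + 1))) (ξ / (2 * (A + 1))) with hh
  have hh0 : 0 < h := lt_min (by positivity) (by positivity)
  have l1 : (B + 1) * h ≤ δ / 2 := by
    calc (B + 1) * h ≤ (B + 1) * (δ / (2 * (B + 1))) :=
          mul_le_mul_of_nonneg_left (min_le_left _ _) hB1.le
      _ = δ / 2 := by field_simp
  have l2 : (A + 1) * h ≤ ξ / 2 := by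
    calc (A + 1) * h ≤ (A + 1) * (ξ / (2 * (A + 1))) :=
          mul_le_mul_of_nonneg_left (min_le_right _ _) hA1.le
      _ = ξ / 2 := by field_simp
  refine (key h hh0 (by nlinarith)).trans ?_
  simp only [Real.norm_eq_abs]
  nlinarith

/-- The chain rule along the moving frame `Y = α (x - c t)`, `T = β t`. Joint differentiability
follows from the bound on the second space derivative. -/
lemma hasDerivWithinAt_moving_frame {r : ℕ} (hr : 2 ≤ r) {a b : κ → ℝ → ℝ → ℝ}
    (ha : a ∈ continuousFamilies κ r) {k : κ} {α β c x t : ℝ} (hβ : 0 ≤ β) (ht : 0 ≤ t)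
    (hd : HasDerivWithinAt (a k (α * (x - c * t))) (b k (α * (x - c * t)) (β * t)) (Set.Ici 0)
      (β * t)) :
    HasDerivWithinAt (fun t => a k (α * (x - c * t)) (β * t))
      (-(α * c) * dSpace (a k) (α * (x - c * t)) (β * t) +
        β * b k (α * (x - c * t)) (β * t)) (Set.Ici 0) t := by
  obtain ⟨B, hB⟩ := exists_derivsBounded_of_mem ha
  have hD : ContinuousOn (dSpace (a k) (α * (x - c * t))) (Set.Ici 0) :=
    (dSpace_mem_continuousFamilies (r := 1) le_rfl (continuousFamilies_of_le hr ha)).2 k _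
  set y := α * (x - c * t) with hy
  have hmaps : Set.MapsTo (fun t => β * t) (Set.Ici 0) (Set.Ici 0) :=
    fun t ht => mul_nonneg hβ ht
  have hβd : HasDerivWithinAt (fun t => β * t) β (Set.Ici 0) t := by
    simpa using (hasDerivWithinAt_id t (Set.Ici 0)).const_mul β
  have h1 : HasDerivWithinAt (fun τ => a k y (β * τ)) (b k y (β * t) * β) (Set.Ici 0) t :=
    hd.comp t hβd hmaps
  have hDt : Filter.Tendsto (fun τ => dSpace (a k) y (β * τ)) (nhdsWithin t (Set.Ici 0))
      (nhds (dSpace (a k) y (β * t))) :=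
    (hD.comp (continuous_const.mul continuous_id).continuousOn hmaps) t ht
  rw [hasDerivWithinAt_iff_isLittleO] at h1 ⊢
  have h2 : (fun τ => (-(α * c)) * ((τ - t) * (dSpace (a k) y (β * τ) - dSpace (a k) y (β * t))))
      =o[nhdsWithin t (Set.Ici 0)] fun τ => τ - t := by
    apply Asymptotics.IsLittleO.const_mul_left
    have : (fun τ => dSpace (a k) y (β * τ) - dSpace (a k) y (β * t))
        =o[nhdsWithin t (Set.Ici 0)] fun _ => (1 : ℝ) := by
      rw [Asymptotics.isLittleO_one_iff]
      simpa using hDt.sub_const (dSpace (a k) y (β * t))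
    simpa using (Asymptotics.isBigO_refl (fun τ => τ - t) _).mul_isLittleO this
  have h3 : (fun τ => a k (α * (x - c * τ)) (β * τ) - a k y (β * τ) -
      (α * (x - c * τ) - y) * dSpace (a k) y (β * τ))
      =o[nhdsWithin t (Set.Ici 0)] fun τ => τ - t := by
    have hO : (fun τ => a k (α * (x - c * τ)) (β * τ) - a k y (β * τ) -
        (α * (x - c * τ) - y) * dSpace (a k) y (β * τ))
        =O[nhdsWithin t (Set.Ici 0)] fun τ => (τ - t) ^ 2 := by
      refine Asymptotics.IsBigO.of_bound (B * (α * c) ^ 2) ?_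
      filter_upwards [self_mem_nhdsWithin] with τ hτ
      have := ((hB k (β * τ) (hmaps hτ)).of_le hr).abs_taylor_le y (α * (x - c * τ))
      refine this.trans (le_of_eq ?_)
      rw [Real.norm_of_nonneg (sq_nonneg _), hy]; ring
    refine hO.trans_isLittleO (Asymptotics.IsLittleO.mono ?_ nhdsWithin_le_nhds)
    simpa only [Real.norm_eq_abs, sq_abs] using Asymptotics.isLittleO_pow_sub_sub t one_lt_two
  refine ((h1.add h2).add h3).congr_left fun τ => ?_
  simp only [smul_eq_mul, hy]
  ring

end EulerPoisson

namespace EulerPoisson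

/-! ### Regularity of the profiles -/

lemma iteratedDeriv_mem_continuousFamilies {κ : Type*} {r i : ℕ} (hr : 1 ≤ r)
    {a : κ → ℝ → ℝ → ℝ} (ha : a ∈ continuousFamilies κ (r + i)) :
    (fun k y T => iteratedDeriv i (fun z => a k z T) y) ∈ continuousFamilies κ r := by
  induction i generalizing a with
  | zero => simpa using ha
  | succ i ih =>
    simp only [iteratedDeriv_succ']
    exact ih (dSpace_mem_continuousFamilies (by omega) ha)

lemma iteratedDeriv_mem_differentiableFamilies {κ : Type*} {r i : ℕ} (hr : 1 ≤ r)
    {a : κ → ℝ → ℝ → ℝ} (ha : a ∈ differentiableFamilies κ (r + i)) :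
    (fun k y T => iteratedDeriv i (fun z => a k z T) y) ∈ differentiableFamilies κ r := by
  induction i generalizing a with
  | zero => simpa using ha
  | succ i ih =>
    simp only [iteratedDeriv_succ']
    exact ih (dSpace_mem_differentiableFamilies (by omega) ha)

/-- A non-unital algebra of functions is closed under differential polynomials without constant
term. -/
lemma evalJet_mem {κ : Type*} (S : NonUnitalSubalgebra ℝ (κ → ℝ → ℝ → ℝ))
    {p : MvPolynomial (ℕ × ℕ) ℝ} (hp : MvPolynomial.constantCoeff p = 0)
    {n : κ → ℕ → ℝ → ℝ → ℝ}
    (h : ∀ ι ∈ p.vars, (fun k y T => iteratedDeriv ι.2 (fun z => n k ι.1 z T) y) ∈ S) :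
    (fun k => evalJet p (n k)) ∈ S := by
  set x : ℕ × ℕ → κ → ℝ → ℝ → ℝ := fun ι k y T => iteratedDeriv ι.2 (fun z => n k ι.1 z T) y
    with hx
  have e : (fun k => evalJet p (n k)) =
      ∑ d ∈ p.support, p.coeff d • ∏ i ∈ d.support, x i ^ d i := by
    funext k y T
    simp [evalJet, MvPolynomial.eval_eq, hx, Finset.sum_apply, Finset.prod_apply]
  have hpow : ∀ v ∈ S, ∀ j : ℕ, j ≠ 0 → v ^ j ∈ S := by
    intro v hv j hj
    induction j with
    | zero => exact absurd rfl hj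
    | succ j ih =>
      rcases Nat.eq_zero_or_pos j with rfl | h0
      · simpa using hv
      · rw [pow_succ]; exact mul_mem (ih h0.ne') hv
  rw [e]
  refine sum_mem fun d hd => SMulMemClass.smul_mem _ ?_
  have hd0 : d.support.Nonempty := by
    rw [Finsupp.support_nonempty_iff]
    rintro rfl
    rw [MvPolynomial.mem_support_iff] at hd
    exact hd (by rw [← MvPolynomial.constantCoeff_eq]; exact hp)
  refine Finset.prod_induction_nonempty _ (· ∈ S) (fun _ _ => mul_mem) hd0 fun i hi => ?_
  exact hpow _ (h i ((MvPolynomial.mem_vars_iff_mem_support i).mpr ⟨d, hd, hi⟩)) _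
    (Finsupp.mem_support_iff.mp hi)

/-- The solutions of the hierarchy up to level `m` with `H^s` norm at most `M`. They index the
families whose uniform bounds give constants that are independent of the solution. -/
def BoundedSolution (τi me : ℝ) (m : ℕ) (R : LocalRelations) (s : ℕ) (M : ℝ≥0) : Type :=
  {P : Profiles // IsApproximateSolution τi me m R P ∧
    (⨆ T ∈ Set.Ici (0 : ℝ), profileNorm s m P T) ≤ (M : ℝ≥0∞)}

/-- A bound for the order of the KdV operator and of the differential polynomials in the relations
up to level `m`. -/
noncomputable def jetOrder (m : ℕ) (R : LocalRelations) : ℕ :=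
  3 + ∑ k ∈ Finset.range m, ((R.f k).vars.sup Prod.snd + (R.g k).vars.sup Prod.snd +
    (R.h k).vars.sup Prod.snd + (R.F k).vars.sup Prod.snd)

lemma snd_le_jetOrder {m k : ℕ} (hk : k < m) {R : LocalRelations} {ι : ℕ × ℕ}
    (h : ι ∈ (R.f k).vars ∨ ι ∈ (R.g k).vars ∨ ι ∈ (R.h k).vars ∨ ι ∈ (R.F k).vars) :
    ι.2 ≤ jetOrder m R := by
  have h1 := Finset.single_le_sum (f := fun k => (R.f k).vars.sup Prod.snd +
    (R.g k).vars.sup Prod.snd + (R.h k).vars.sup Prod.snd + (R.F k).vars.sup Prod.snd)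
    (fun _ _ => Nat.zero_le _) (Finset.mem_range.mpr hk)
  simp only [jetOrder]
  rcases h with h | h | h | h <;>
  · have := Finset.le_sup (f := Prod.snd) h
    omega

section

variable {τi me : ℝ} {m : ℕ} {R : LocalRelations} {s : ℕ} {M : ℝ≥0}

lemma BoundedSolution.hsNorm_le (P : BoundedSolution τi me m R s M) {k : ℕ} (h1 : 1 ≤ k)
    (hk : k ≤ m) {T : ℝ} (hT : 0 ≤ T) :
    hsNorm s (fun y => P.1.nP k y T) ≤ M ∧ hsNorm s (fun y => P.1.nM k y T) ≤ M ∧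
    hsNorm s (fun y => P.1.vP k y T) ≤ M ∧ hsNorm s (fun y => P.1.vM k y T) ≤ M ∧
    hsNorm s (fun y => P.1.φ k y T) ≤ M := by
  have h : profileNorm s m P.1 T ≤ M :=
    (le_iSup₂ (f := fun T (_ : T ∈ Set.Ici (0 : ℝ)) => profileNorm s m P.1 T) T hT).trans P.2.2
  have h' := (Finset.single_le_sum (f := fun k => hsNorm s (fun y => P.1.nP k y T) +
    hsNorm s (fun y => P.1.nM k y T) + hsNorm s (fun y => P.1.vP k y T) +
    hsNorm s (fun y => P.1.vM k y T) + hsNorm s (fun y => P.1.φ k y T))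
    (fun _ _ => zero_le) (Finset.mem_Icc.mpr ⟨h1, hk⟩)).trans h
  refine ⟨?_, ?_, ?_, ?_, ?_⟩ <;> refine le_trans ?_ h'
  · exact le_self_add.trans (le_self_add.trans (le_self_add.trans le_self_add))
  · exact le_add_self.trans (le_self_add.trans (le_self_add.trans le_self_add))
  · exact le_add_self.trans (le_self_add.trans le_self_add)
  · exact le_add_self.trans le_self_add
  · exact le_add_self

lemma potential_mem_uniformFamilies {r : ℕ} (hr : r + 1 ≤ s) {k : ℕ} (h1 : 1 ≤ k)
    (hk : k ≤ m) :
    (fun (i : BoundedSolution τi me m R s M × ℝ≥0) y => i.1.1.φ k y i.2) ∈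
      uniformFamilies _ r :=
  ⟨_, fun i => derivsBounded_of_hsNorm_le hr
    (i.1.2.1.continuous_space k h1 hk i.2 i.2.2).2.2.2.2
    (i.1.hsNorm_le h1 hk i.2.2).2.2.2.2⟩

lemma density_mem_continuousFamilies {r : ℕ} (hr : r + 1 ≤ s) {k : ℕ} (h1 : 1 ≤ k)
    (hk : k ≤ m) :
    (fun (P : BoundedSolution τi me m R s M) => P.1.nP k) ∈ continuousFamilies _ r :=
  ⟨⟨_, fun i => derivsBounded_of_hsNorm_le hr (i.1.2.1.continuous_space k h1 hk i.2 i.2.2).1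
    (i.1.hsNorm_le h1 hk i.2.2).1⟩,
    fun P y => (P.2.1.differentiable_time k h1 hk y).1.continuousOn⟩

lemma mem_continuousFamilies_of_isDiffPoly {r : ℕ} (hr : 1 ≤ r)
    (hrs : r + jetOrder m R + 1 ≤ s) {k : ℕ} (hk : k < m) {p : MvPolynomial (ℕ × ℕ) ℝ}
    (hp : IsDiffPoly k p) (hord : ∀ ι ∈ p.vars, ι.2 ≤ jetOrder m R) :
    (fun (P : BoundedSolution τi me m R s M) => evalJet p P.1.nP) ∈ continuousFamilies _ r :=
  evalJet_mem _ hp.2 fun ι hι => iteratedDeriv_mem_continuousFamilies hr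
    (density_mem_continuousFamilies (by have := hord ι hι; omega) (hp.1 ι hι).1
      ((hp.1 ι hι).2.trans hk.le))

/-- The KdV equations express the time derivatives of the ion densities by space derivatives. -/
lemma density_mem_differentiableFamilies {r : ℕ} (hr : 1 ≤ r)
    (hrs : r + jetOrder m R + 1 ≤ s) {k : ℕ} (h1 : 1 ≤ k) (hk : k ≤ m) :
    (fun (P : BoundedSolution τi me m R s M) => P.1.nP k) ∈ differentiableFamilies _ r := by
  have h3 : 3 ≤ jetOrder m R := by simp [jetOrder]
  have hn : ∀ j, 1 ≤ j → j ≤ m →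
      (fun (P : BoundedSolution τi me m R s M) => P.1.nP j) ∈ continuousFamilies _ (r + 3) :=
    fun j hj1 hj => density_mem_continuousFamilies (by omega) hj1 hj
  have hxxx : (fun (P : BoundedSolution τi me m R s M) =>
      dSpace (dSpace (dSpace (P.1.nP k)))) ∈ continuousFamilies _ r :=
    dSpace_mem_continuousFamilies (by omega) (dSpace_mem_continuousFamilies (by omega)
      (dSpace_mem_continuousFamilies (by omega) (hn k h1 hk)))
  refine ⟨continuousFamilies_of_le (by omega) (hn k h1 hk), fun P => dTime (P.1.nP k), ?_,
    fun P y T hT => ((P.2.1.differentiable_time k h1 hk y).1 T hT).hasDerivWithinAt⟩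
  rcases h1.eq_or_lt with rfl | h2
  · refine continuousFamilies_congr (b := -(soundSpeed τi me •
      ((fun P => P.1.nP 1) * fun P => dSpace (P.1.nP 1)) + dispersion τi me •
      fun (P : BoundedSolution τi me m R s M) => dSpace (dSpace (dSpace (P.1.nP 1))))) ?_ ?_
    · intro P y T hT
      have := P.2.1.kdv_one y T hT
      simp only [Pi.neg_apply, Pi.add_apply, Pi.smul_apply, Pi.mul_apply, smul_eq_mul]
      linarith
    · exact neg_mem (add_mem (SMulMemClass.smul_mem _ (mul_mem
        (continuousFamilies_of_le (by omega) (hn 1 le_rfl hk))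
        (dSpace_mem_continuousFamilies hr (continuousFamilies_of_le (by omega) (hn 1 le_rfl hk)))))
        (SMulMemClass.smul_mem _ hxxx))
  · refine continuousFamilies_congr (b := (fun P => evalJet (R.F (k - 1)) P.1.nP) -
      (soundSpeed τi me •
      (fun P => dSpace (fun y r => P.1.nP 1 y r * P.1.nP k y r)) + dispersion τi me •
      fun (P : BoundedSolution τi me m R s M) => dSpace (dSpace (dSpace (P.1.nP k))))) ?_ ?_
    · intro P y T hT
      have := P.2.1.kdv_lin k h2 hk y T hT
      simp only [Pi.sub_apply, Pi.add_apply, Pi.smul_apply, smul_eq_mul]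
      linarith
    · refine sub_mem (mem_continuousFamilies_of_isDiffPoly hr hrs (k := k - 1) (by omega)
        (R.isDiffPoly (k - 1)).2.2.2 fun ι hι => snd_le_jetOrder (k := k - 1) (by omega)
        (Or.inr (Or.inr (Or.inr hι)))) (add_mem (SMulMemClass.smul_mem _ ?_)
        (SMulMemClass.smul_mem _ hxxx))
      exact dSpace_mem_continuousFamilies hr (mul_mem
        (continuousFamilies_of_le (by omega) (hn 1 le_rfl (by omega)))
        (continuousFamilies_of_le (by omega) (hn k h1 hk)))

lemma mem_differentiableFamilies_of_isDiffPoly {r : ℕ} (hr : 1 ≤ r)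
    (hrs : r + 2 * jetOrder m R + 1 ≤ s) {k : ℕ} (hk : k < m) {p : MvPolynomial (ℕ × ℕ) ℝ}
    (hp : IsDiffPoly k p) (hord : ∀ ι ∈ p.vars, ι.2 ≤ jetOrder m R) :
    (fun (P : BoundedSolution τi me m R s M) => evalJet p P.1.nP) ∈
      differentiableFamilies _ r :=
  evalJet_mem _ hp.2 fun ι hι => iteratedDeriv_mem_differentiableFamilies hr
    (density_mem_differentiableFamilies (by omega) (by have := hord ι hι; omega) (hp.1 ι hι).1
      ((hp.1 ι hι).2.trans hk.le))

/-- The remaining time-dependent profiles are slaved to the ion densities, so that their time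
derivatives are controlled as well. -/
lemma slaved_mem_differentiableFamilies {r : ℕ} (hr : 1 ≤ r)
    (hrs : r + 2 * jetOrder m R + 1 ≤ s) {k : ℕ} (h1 : 1 ≤ k) (hk : k ≤ m) :
    (fun (P : BoundedSolution τi me m R s M) => P.1.nM k) ∈ differentiableFamilies _ r ∧
    (fun (P : BoundedSolution τi me m R s M) => P.1.vP k) ∈ differentiableFamilies _ r ∧
    (fun (P : BoundedSolution τi me m R s M) => P.1.vM k) ∈ differentiableFamilies _ r := by
  have hn : (fun (P : BoundedSolution τi me m R s M) => P.1.nP k) ∈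
      differentiableFamilies _ r := density_mem_differentiableFamilies hr (by omega) h1 hk
  have hlt : k - 1 < m := by omega
  refine ⟨?_, ?_, ?_⟩
  · exact differentiableFamilies_congr
      (fun P y T hT => (P.2.1.slaved k h1 hk y T hT).1) (add_mem hn
      (mem_differentiableFamilies_of_isDiffPoly hr hrs hlt (R.isDiffPoly (k - 1)).1 fun ι hι =>
        snd_le_jetOrder hlt (Or.inl hι)))
  · exact differentiableFamilies_congr
      (fun P y T hT => (P.2.1.slaved k h1 hk y T hT).2.1)
      (add_mem (SMulMemClass.smul_mem (soundSpeed τi me) hn)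
      (mem_differentiableFamilies_of_isDiffPoly hr hrs hlt (R.isDiffPoly (k - 1)).2.1 fun ι hι =>
        snd_le_jetOrder hlt (Or.inr (Or.inl hι))))
  · exact differentiableFamilies_congr
      (fun P y T hT => (P.2.1.slaved k h1 hk y T hT).2.2)
      (add_mem (SMulMemClass.smul_mem (soundSpeed τi me) hn)
      (mem_differentiableFamilies_of_isDiffPoly hr hrs hlt (R.isDiffPoly (k - 1)).2.2.1
        fun ι hι => snd_le_jetOrder hlt (Or.inr (Or.inr (Or.inl hι)))))

end

end EulerPoisson

namespace EulerPoisson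

/-! ### Expansions in the small parameter as polynomials -/

section

open Polynomial

/-- The polynomial `∑_{k=1}^{m} a_k X^k`, where `X` stands for the small parameter. -/
noncomputable def expansion {A : Type*} [Semiring A] (m : ℕ) (a : ℕ → A) : A[X] :=
  ∑ k ∈ Finset.Icc 1 m, monomial k (a k)

lemma coeff_expansion {A : Type*} [Semiring A] (m : ℕ) (a : ℕ → A) (k : ℕ) :
    (expansion m a).coeff k = if 1 ≤ k ∧ k ≤ m then a k else 0 := by
  simp [expansion, coeff_monomial, Finset.sum_ite_eq', Finset.mem_Icc]

lemma X_dvd_expansion {A : Type*} [CommRing A] (m : ℕ) (a : ℕ → A) :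
    (X : A[X]) ∣ expansion m a := by
  rw [X_dvd_iff, coeff_expansion]; simp

lemma coeff_expansion_mul_expansion {A : Type*} [CommRing A] {m k : ℕ} (a b : ℕ → A)
    (hk : k ≤ m) :
    (expansion m a * expansion m b).coeff (k + 1) =
      ∑ j ∈ Finset.Icc 1 k, a j * b (k + 1 - j) := by
  rw [coeff_mul, Finset.Nat.sum_antidiagonal_eq_sum_range_succ
    (fun i j => (expansion m a).coeff i * (expansion m b).coeff j)]
  symm
  refine Finset.sum_subset_zero_on_sdiff (fun j hj => ?_) (fun j hj => ?_) fun j hj => ?_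
  · simp only [Finset.mem_Icc] at hj; simp only [Finset.mem_range]; omega
  · simp only [Finset.mem_sdiff, Finset.mem_range, Finset.mem_Icc, not_and_or, not_le] at hj
    rw [coeff_expansion, coeff_expansion]
    rcases hj.2 with h | h
    · rw [if_neg (by omega), zero_mul]
    · rw [if_neg (c := 1 ≤ k + 1 - j ∧ _) (by omega), mul_zero]
  · simp only [Finset.mem_Icc] at hj
    rw [coeff_expansion, coeff_expansion, if_pos (by omega), if_pos (by omega)]

lemma coeff_expansion_mul_expansion_of_le_one {A : Type*} [CommRing A] {m k : ℕ} (a b : ℕ → A)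
    (hk : k ≤ 1) : (expansion m a * expansion m b).coeff k = 0 := by
  have : (X : A[X]) ^ 2 ∣ expansion m a * expansion m b := by
    rw [pow_two]; exact mul_dvd_mul (X_dvd_expansion m a) (X_dvd_expansion m b)
  exact X_pow_dvd_iff.mp this k (by omega)

lemma coeff_expansion_pow_of_lt {A : Type*} [CommRing A] {m k j : ℕ} (a : ℕ → A)
    (hk : k < j) : (expansion m a ^ j).coeff k = 0 :=
  X_pow_dvd_iff.mp (pow_dvd_pow_of_dvd (X_dvd_expansion m a) j) k hk

/-- The terms of order above `K` do not contribute to the coefficient of order `K` of a power, which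
the multinomial theorem then computes. -/
lemma coeff_expansion_pow {A : Type*} [CommRing A] {m K : ℕ} (hK : K ≤ m) (a : ℕ → A) (j : ℕ) :
    (expansion m a ^ j).coeff K =
      ∑ e ∈ (Finset.piAntidiag (Finset.Icc 1 K) j).filter
        (fun e => ∑ i ∈ Finset.Icc 1 K, i * e i = K),
      (Nat.multinomial (Finset.Icc 1 K) e : A) * ∏ i ∈ Finset.Icc 1 K, a i ^ e i := by
  have h1 : (X : A[X]) ^ (K + 1) ∣ expansion m a - expansion K a := by
    rw [X_pow_dvd_iff]
    intro d hd
    rw [coeff_sub, coeff_expansion, coeff_expansion, sub_eq_zero]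
    congr 1
    exact propext ⟨fun h => ⟨h.1, by omega⟩, fun h => ⟨h.1, by omega⟩⟩
  have h2 := X_pow_dvd_iff.mp (h1.trans (sub_dvd_pow_sub_pow _ _ j)) K (by omega)
  rw [coeff_sub, sub_eq_zero] at h2
  rw [h2, expansion, Finset.sum_pow_eq_sum_piAntidiag, finsetSum_coeff, Finset.sum_filter]
  refine Finset.sum_congr rfl fun e _ => ?_
  have hprod : ∏ i ∈ Finset.Icc 1 K, (monomial i (a i)) ^ e i =
      monomial (∑ i ∈ Finset.Icc 1 K, i * e i) (∏ i ∈ Finset.Icc 1 K, a i ^ e i) := by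
    simp only [monomial_pow]
    induction Finset.Icc 1 K using Finset.induction_on with
    | empty => simp
    | insert x t hx ih =>
      rw [Finset.prod_insert hx, ih, monomial_mul_monomial, Finset.sum_insert hx,
        Finset.prod_insert hx]
  rw [hprod, ← C_eq_natCast, coeff_C_mul, coeff_monomial]
  split_ifs <;> simp

variable {ι : Type*}

/-- The value of a polynomial in the small parameter, whose coefficients are a family of
functions, at the parameter `ε`, the member `i` of the family and the point `y`. -/
noncomputable def evalExpansion (ε : ℝ) (i : ι) (y : ℝ) : (ι → ℝ → ℝ)[X] →ₐ[ℝ] ℝ :=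
  (aeval ε).comp (mapAlgHom ((Pi.evalAlgHom ℝ (fun _ => ℝ) y).comp
    (Pi.evalAlgHom ℝ (fun _ => ℝ → ℝ) i)))

lemma evalExpansion_monomial (ε : ℝ) (i : ι) (y : ℝ) (k : ℕ) (a : ι → ℝ → ℝ) :
    evalExpansion ε i y (monomial k a) = ε ^ k * a i y := by
  simp [evalExpansion, mul_comm]

lemma evalExpansion_X (ε : ℝ) (i : ι) (y : ℝ) : evalExpansion ε i y X = ε := by
  simp [evalExpansion]

lemma evalExpansion_eq_sum (ε : ℝ) (i : ι) (y : ℝ) (p : (ι → ℝ → ℝ)[X]) :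
    evalExpansion ε i y p = ∑ k ∈ p.support, ε ^ k * p.coeff k i y := by
  conv_lhs => rw [p.as_sum_support, map_sum]
  simp only [evalExpansion_monomial]

lemma evalExpansion_expansion (ε : ℝ) (i : ι) (y : ℝ) (m : ℕ) (a : ℕ → ι → ℝ → ℝ) :
    evalExpansion ε i y (expansion m a) = ∑ k ∈ Finset.Icc 1 m, ε ^ k * a k i y := by
  simp only [expansion, map_sum, evalExpansion_monomial]

/-- The coefficientwise space derivative. -/
noncomputable def spaceDeriv (p : (ι → ℝ → ℝ)[X]) : (ι → ℝ → ℝ)[X] :=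
  ∑ k ∈ p.support, monomial k fun i => deriv (p.coeff k i)

lemma coeff_spaceDeriv (p : (ι → ℝ → ℝ)[X]) (k : ℕ) :
    (spaceDeriv p).coeff k = fun i => deriv (p.coeff k i) := by
  simp only [spaceDeriv, finsetSum_coeff, coeff_monomial, Finset.sum_ite_eq']
  split_ifs with h
  · rfl
  · rw [notMem_support_iff.mp h]
    funext i y
    simp

lemma spaceDeriv_apply_coeff (p : (ι → ℝ → ℝ)[X]) (k : ℕ) (i : ι) (y : ℝ) :
    (spaceDeriv p).coeff k i y = deriv (p.coeff k i) y := by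
  rw [coeff_spaceDeriv]

lemma evalExpansion_spaceDeriv (ε : ℝ) (i : ι) (y : ℝ) (p : (ι → ℝ → ℝ)[X]) :
    evalExpansion ε i y (spaceDeriv p) = ∑ k ∈ p.support, ε ^ k * deriv (p.coeff k i) y := by
  simp only [spaceDeriv, map_sum, evalExpansion_monomial]

/-- All coefficients form uniform families with `r` derivatives. -/
def HasUniformCoeffs (r : ℕ) (p : (ι → ℝ → ℝ)[X]) : Prop :=
  ∀ k, p.coeff k ∈ uniformFamilies ι r

lemma HasUniformCoeffs.mul {r : ℕ} {p q : (ι → ℝ → ℝ)[X]} (hp : HasUniformCoeffs r p)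
    (hq : HasUniformCoeffs r q) : HasUniformCoeffs r (p * q) := fun k => by
  rw [coeff_mul]
  exact sum_mem fun x _ => mul_mem (hp _) (hq _)

lemma HasUniformCoeffs.pow {r : ℕ} {p : (ι → ℝ → ℝ)[X]} (hp : HasUniformCoeffs r p) {j : ℕ}
    (hj : 1 ≤ j) : HasUniformCoeffs r (p ^ j) := by
  induction j, hj using Nat.le_induction with
  | base => simpa using hp
  | succ j _ ih => rw [pow_succ]; exact ih.mul hp

lemma HasUniformCoeffs.add {r : ℕ} {p q : (ι → ℝ → ℝ)[X]} (hp : HasUniformCoeffs r p)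
    (hq : HasUniformCoeffs r q) : HasUniformCoeffs r (p + q) := fun k => by
  rw [coeff_add]
  exact add_mem (hp _) (hq _)

lemma HasUniformCoeffs.smul {r : ℕ} {p : (ι → ℝ → ℝ)[X]} (hp : HasUniformCoeffs r p) (c : ℝ) :
    HasUniformCoeffs r (c • p) := fun k => by
  rw [coeff_smul]
  exact SMulMemClass.smul_mem c (hp k)

lemma HasUniformCoeffs.sum {r : ℕ} {α : Type*} {t : Finset α} {p : α → (ι → ℝ → ℝ)[X]}
    (hp : ∀ j ∈ t, HasUniformCoeffs r (p j)) : HasUniformCoeffs r (∑ j ∈ t, p j) := fun k => by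
  rw [finsetSum_coeff]
  exact sum_mem fun j hj => hp j hj k

lemma HasUniformCoeffs.X_mul {r : ℕ} {p : (ι → ℝ → ℝ)[X]} (hp : HasUniformCoeffs r p) :
    HasUniformCoeffs r (X * p) := fun k => by
  cases k with
  | zero => rw [coeff_X_mul_zero]; exact zero_mem _
  | succ k => rw [coeff_X_mul]; exact hp k

lemma HasUniformCoeffs.of_le {r r' : ℕ} (h : r ≤ r') {p : (ι → ℝ → ℝ)[X]}
    (hp : HasUniformCoeffs r' p) : HasUniformCoeffs r p :=
  fun k => uniformFamilies_of_le h (hp k)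

lemma HasUniformCoeffs.spaceDeriv {r : ℕ} {p : (ι → ℝ → ℝ)[X]}
    (hp : HasUniformCoeffs (r + 1) p) : HasUniformCoeffs r (spaceDeriv p) := fun k => by
  rw [coeff_spaceDeriv]
  exact deriv_mem_uniformFamilies (hp k)

lemma hasUniformCoeffs_expansion {r m : ℕ} {a : ℕ → ι → ℝ → ℝ}
    (h : ∀ k, 1 ≤ k → k ≤ m → a k ∈ uniformFamilies ι r) :
    HasUniformCoeffs r (expansion m a) := fun k => by
  rw [coeff_expansion]
  split_ifs with hk
  · exact h k hk.1 hk.2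
  · exact zero_mem _

lemma HasUniformCoeffs.differentiable {r : ℕ} {p : (ι → ℝ → ℝ)[X]}
    (hp : HasUniformCoeffs (r + 1) p) (k : ℕ) (i : ι) : Differentiable ℝ (p.coeff k i) :=
  let ⟨_, hB⟩ := hp k; (hB i).2.1

lemma HasUniformCoeffs.hasDerivAt_evalExpansion {p : (ι → ℝ → ℝ)[X]}
    (hp : HasUniformCoeffs 1 p) (ε : ℝ) (i : ι) (α b x : ℝ) :
    HasDerivAt (fun x => evalExpansion ε i (α * (x - b)) p)
      (α * evalExpansion ε i (α * (x - b)) (EulerPoisson.spaceDeriv p)) x := by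
  simp only [evalExpansion_spaceDeriv, evalExpansion_eq_sum ε i _ p, Finset.mul_sum]
  refine HasDerivAt.fun_sum fun k _ => ?_
  have h1 : HasDerivAt (fun x => α * (x - b)) α x := by
    simpa using ((hasDerivAt_id x).sub_const b).const_mul α
  have h2 := ((hp.differentiable k i (α * (x - b))).hasDerivAt.comp x h1).const_mul (ε ^ k)
  exact h2.congr_deriv (by ring)

/-! ### Norms of remainders -/

/-- A dilation by `ε^{1/2}` multiplies the `L²` norm by `ε^{-1/4}`. -/
lemma eLpNorm_dilation_le {f : ℝ → ℝ} {B : ℝ≥0} (hf : BoundedL2 B f) {ε : ℝ} (hε : 0 < ε)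
    (b : ℝ) :
    MemLp (fun x => f (ε ^ (1 / 2 : ℝ) * (x - b))) 2 volume ∧
    eLpNorm (fun x => f (ε ^ (1 / 2 : ℝ) * (x - b))) 2 volume ≤
      ENNReal.ofReal (ε ^ (-(1 / 4) : ℝ) * B) := by
  set α := ε ^ (1 / 2 : ℝ) with hα
  have hα0 : 0 < α := Real.rpow_pos_of_pos hε _
  have hle : eLpNorm (fun x => f (α * (x - b))) 2 volume ≤
      ENNReal.ofReal (ε ^ (-(1 / 4) : ℝ) * B) := by
    have h1 : eLpNorm (fun x => f (α * (x - b))) 2 volume =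
        eLpNorm (fun x => f (α * x)) 2 volume :=
      eLpNorm_comp_measurePreserving (g := fun x => f (α * x)) (f := fun x => x - b)
        (hf.1.comp (continuous_const.mul continuous_id)).aestronglyMeasurable
        (measurePreserving_sub_right volume b)
    have h2 : eLpNorm (fun x => f (α * x)) 2 volume =
        eLpNorm f 2 (Measure.map (fun x => α * x) volume) :=
      (eLpNorm_map_measure hf.1.aestronglyMeasurable
        (measurable_const_mul α).aemeasurable).symm
    rw [h1, h2, Real.map_volume_mul_left hα0.ne',
      eLpNorm_smul_measure_of_ne_top (by norm_num), smul_eq_mul,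
      ENNReal.ofReal_mul (Real.rpow_nonneg hε.le _), ENNReal.ofReal_coe_nnreal]
    refine mul_le_mul' (le_of_eq ?_) hf.2.2
    rw [abs_of_pos (inv_pos.mpr hα0), ENNReal.ofReal_rpow_of_pos (inv_pos.mpr hα0), hα,
      ← Real.rpow_neg hε.le, ← Real.rpow_mul hε.le]
    norm_num
  exact ⟨⟨(hf.1.comp (continuous_const.mul
    (continuous_id.sub continuous_const))).aestronglyMeasurable,
    hle.trans_lt ENNReal.ofReal_lt_top⟩, hle⟩

/-- If the coefficients of order at most `m` vanish, the value is of order `ε^{m+1}`; the dilation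
costs a factor `ε^{-1/4}` and the normalization gains `ε^{1-m}`. -/
lemma HasUniformCoeffs.exists_residual_bound {m : ℕ} {q : (ι → ℝ → ℝ)[X]}
    (hq : HasUniformCoeffs 0 q) (h0 : ∀ k ≤ m, q.coeff k = 0) :
    ∃ C : ℝ, 0 < C ∧ ∀ ε : ℝ, 0 < ε → ε ≤ 1 → ∀ (i : ι) (b : ℝ),
      MemLp (fun x => ε ^ (1 - (m : ℤ)) * evalExpansion ε i (ε ^ (1 / 2 : ℝ) * (x - b)) q) 2
        volume ∧
      eLpNorm (fun x => ε ^ (1 - (m : ℤ)) *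
        evalExpansion ε i (ε ^ (1 / 2 : ℝ) * (x - b)) q) 2 volume ≤
        ENNReal.ofReal (C * ε ^ (7 / 4 : ℝ)) := by
  choose B hB using hq
  refine ⟨(∑ k ∈ q.support, (B k : ℝ)) + 1, by positivity, fun ε hε hε1 i b => ?_⟩
  have hb : ∀ k, MemLp (fun x => q.coeff k i (ε ^ (1 / 2 : ℝ) * (x - b))) 2 volume ∧
      eLpNorm (fun x => q.coeff k i (ε ^ (1 / 2 : ℝ) * (x - b))) 2 volume ≤
      ENNReal.ofReal (ε ^ (-(1 / 4) : ℝ) * B k) :=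
    fun k => eLpNorm_dilation_le (hB k i) hε b
  have e : (fun x => ε ^ (1 - (m : ℤ)) * evalExpansion ε i (ε ^ (1 / 2 : ℝ) * (x - b)) q) =
      ∑ k ∈ q.support, (ε ^ (1 - (m : ℤ)) * ε ^ k) •
        fun x => q.coeff k i (ε ^ (1 / 2 : ℝ) * (x - b)) := by
    funext x
    rw [evalExpansion_eq_sum, Finset.mul_sum, Finset.sum_apply]
    exact Finset.sum_congr rfl fun k _ => (mul_assoc _ _ _).symm
  have hm : ∀ k, MemLp ((ε ^ (1 - (m : ℤ)) * ε ^ k) •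
      fun x => q.coeff k i (ε ^ (1 / 2 : ℝ) * (x - b))) 2 volume :=
    fun k => (hb k).1.const_smul _
  rw [e]
  refine ⟨memLp_finsetSum' _ fun k _ => hm k, ?_⟩
  refine (eLpNorm_sum_le (fun k _ => (hm k).1) (by norm_num)).trans ?_
  have hterm : ∀ k ∈ q.support, eLpNorm ((ε ^ (1 - (m : ℤ)) * ε ^ k) •
      fun x => q.coeff k i (ε ^ (1 / 2 : ℝ) * (x - b))) 2 volume ≤
      ENNReal.ofReal (B k * ε ^ (7 / 4 : ℝ)) := by
    intro k hk
    have hmk : m + 1 ≤ k := by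
      by_contra hlt
      exact mem_support_iff.mp hk (h0 k (by omega))
    -- Here `1 - m + k ≥ 2`, and `2 - 1/4 = 7/4`.
    have hpow : ε ^ (1 - (m : ℤ)) * ε ^ k ≤ ε ^ 2 := by
      rw [← zpow_natCast, ← zpow_add₀ hε.ne', ← zpow_natCast ε 2]
      exact zpow_le_zpow_right_of_le_one₀ hε hε1 (by push_cast; omega)
    rw [eLpNorm_const_smul, Real.enorm_of_nonneg (by positivity)]
    refine (mul_le_mul' (ENNReal.ofReal_le_ofReal hpow) (hb k).2).trans (le_of_eq ?_)
    rw [← ENNReal.ofReal_mul (by positivity)]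
    congr 1
    rw [← mul_assoc, mul_comm, ← Real.rpow_natCast ε 2, ← Real.rpow_add hε]
    norm_num
  refine (Finset.sum_le_sum hterm).trans ?_
  rw [← ENNReal.ofReal_sum_of_nonneg (fun k _ => by positivity), ← Finset.sum_mul]
  refine ENNReal.ofReal_le_ofReal (mul_le_mul_of_nonneg_right (by linarith) (by positivity))

end

end EulerPoisson

namespace EulerPoisson

/-! ### The residuals -/

section

open Polynomial

variable {κ : Type*}

/-- The family of the time slices `T ≥ 0` of a space-time family. -/
def slices (a : κ → ℝ → ℝ → ℝ) : κ × ℝ≥0 → ℝ → ℝ := fun i y => a i.1 y i.2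

lemma deriv_slices (a : κ → ℝ → ℝ → ℝ) (i : κ × ℝ≥0) (y : ℝ) :
    deriv (slices a i) y = dSpace (a i.1) y i.2 := rfl

lemma slices_apply (a : κ → ℝ → ℝ → ℝ) (i : κ × ℝ≥0) (y : ℝ) :
    slices a i y = a i.1 y i.2 := rfl

/-- The expansion with the time slices of the given families as coefficients. -/
noncomputable def sliceExpansion (m : ℕ) (a : ℕ → κ → ℝ → ℝ → ℝ) : (κ × ℝ≥0 → ℝ → ℝ)[X] :=
  expansion m fun k => slices (a k)

/-- The member of the family and the slow time `T = ε^{3/2} t`. -/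
noncomputable def slowIndex (P : κ) (ε t : ℝ) : κ × ℝ≥0 := (P, (ε ^ (3 / 2 : ℝ) * t).toNNReal)

/-- The value of an expansion at the slow variables of the point `(x, t)`. -/
noncomputable def physical (c ε : ℝ) (P : κ) (q : (κ × ℝ≥0 → ℝ → ℝ)[X]) (x t : ℝ) : ℝ :=
  evalExpansion ε (slowIndex P ε t) (ε ^ (1 / 2 : ℝ) * (x - c * t)) q

lemma slowIndex_snd {P : κ} {ε t : ℝ} (hε : 0 < ε) (ht : 0 ≤ t) :
    ((slowIndex P ε t).2 : ℝ) = ε ^ (3 / 2 : ℝ) * t :=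
  Real.coe_toNNReal _ (by positivity)

lemma truncated_eq_physical {m : ℕ} (a : ℕ → κ → ℝ → ℝ → ℝ) (c : ℝ) {ε : ℝ} (hε : 0 < ε)
    (P : κ) (x : ℝ) {t : ℝ} (ht : 0 ≤ t) :
    truncated c ε m (fun k => a k P) x t = physical c ε P (sliceExpansion m a) x t := by
  rw [physical, sliceExpansion, evalExpansion_expansion]
  simp only [slices, slowIndex_snd hε ht]
  rfl

lemma dSpace_eq_physical {q : (κ × ℝ≥0 → ℝ → ℝ)[X]} (hq : HasUniformCoeffs 1 q) {c ε : ℝ}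
    {P : κ} {u : ℝ → ℝ → ℝ} {t : ℝ} (hu : ∀ x, u x t = physical c ε P q x t) (x : ℝ) :
    dSpace u x t = ε ^ (1 / 2 : ℝ) * physical c ε P (spaceDeriv q) x t := by
  rw [dSpace, funext hu]
  exact (hq.hasDerivAt_evalExpansion ε _ _ _ x).deriv

lemma dTime_spec {r : ℕ} {a : κ → ℝ → ℝ → ℝ} (ha : a ∈ differentiableFamilies κ r) :
    (fun k => dTime (a k)) ∈ continuousFamilies κ r ∧ ∀ k y T, 0 ≤ T →
      HasDerivWithinAt (a k y) (dTime (a k) y T) (Set.Ici 0) T := by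
  obtain ⟨-, b, hb, hd⟩ := ha
  have e : ∀ k y T, 0 ≤ T → dTime (a k) y T = b k y T := fun k y T hT =>
    (hd k y T hT).derivWithin (uniqueDiffOn_Ici 0 T hT)
  exact ⟨continuousFamilies_congr e hb, fun k y T hT => by rw [e k y T hT]; exact hd k y T hT⟩

/-- In the moving frame `∂_t = ε^{1/2} (-c ∂_Y + ε ∂_T)`. -/
lemma hasDerivWithinAt_truncated {m : ℕ} {a : ℕ → κ → ℝ → ℝ → ℝ}
    (ha : ∀ k, 1 ≤ k → k ≤ m → a k ∈ differentiableFamilies κ 2) (c : ℝ) {ε : ℝ} (hε : 0 < ε)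
    (P : κ) (x : ℝ) {t : ℝ} (ht : 0 ≤ t) :
    HasDerivWithinAt (fun t => truncated c ε m (fun k => a k P) x t)
      (ε ^ (1 / 2 : ℝ) * physical c ε P
        (-(c • spaceDeriv (sliceExpansion m a)) +
          X * sliceExpansion m fun k P => dTime (a k P)) x t) (Set.Ici 0) t := by
  have hα : ε ^ (3 / 2 : ℝ) = ε ^ (1 / 2 : ℝ) * ε := by
    conv_rhs => rw [← Real.rpow_one ε, ← Real.rpow_mul hε.le, ← Real.rpow_add hε]
    norm_num
  have hs : spaceDeriv (sliceExpansion m a) =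
      sliceExpansion m fun k P => dSpace (a k P) := by
    ext k i y
    rw [spaceDeriv_apply_coeff, sliceExpansion, sliceExpansion, coeff_expansion, coeff_expansion]
    split_ifs
    · rfl
    · exact deriv_const y 0
  have h : HasDerivWithinAt (fun t => truncated c ε m (fun k => a k P) x t)
      (∑ k ∈ Finset.Icc 1 m, ε ^ k *
        (-(ε ^ (1 / 2 : ℝ) * c) * dSpace (a k P) (ε ^ (1 / 2 : ℝ) * (x - c * t))
          (ε ^ (3 / 2 : ℝ) * t) + ε ^ (3 / 2 : ℝ) *
          dTime (a k P) (ε ^ (1 / 2 : ℝ) * (x - c * t)) (ε ^ (3 / 2 : ℝ) * t)))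
      (Set.Ici 0) t := by
    refine HasDerivWithinAt.fun_sum fun k hk => ?_
    obtain ⟨h1, hm⟩ := Finset.mem_Icc.mp hk
    exact (hasDerivWithinAt_moving_frame (b := fun P => dTime (a k P)) le_rfl (ha k h1 hm).1
      (by positivity) ht ((dTime_spec (ha k h1 hm)).2 P _ _ (by positivity))).const_mul (ε ^ k)
  refine h.congr_deriv ?_
  rw [hs]
  simp only [physical, map_add, map_neg, map_smul, map_mul, evalExpansion_X, sliceExpansion,
    evalExpansion_expansion, slices, slowIndex_snd hε ht, smul_eq_mul]
  rw [Finset.mul_sum, Finset.mul_sum, ← Finset.sum_neg_distrib, ← Finset.sum_add_distrib,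
    Finset.mul_sum]
  refine Finset.sum_congr rfl fun k _ => ?_
  rw [hα]
  simp only [slowIndex]
  ring

lemma hasUniformCoeffs_sliceExpansion {r m : ℕ} {a : ℕ → κ → ℝ → ℝ → ℝ}
    (ha : ∀ k, 1 ≤ k → k ≤ m → a k ∈ continuousFamilies κ r) :
    HasUniformCoeffs r (sliceExpansion m a) :=
  hasUniformCoeffs_expansion fun k h1 hm => (ha k h1 hm).1

lemma sliceExpansion_coeff {m : ℕ} (a : ℕ → κ → ℝ → ℝ → ℝ) {k : ℕ} (h1 : 1 ≤ k) (hm : k ≤ m) :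
    (sliceExpansion m a).coeff k = slices (a k) := by
  rw [sliceExpansion, coeff_expansion, if_pos ⟨h1, hm⟩]

lemma sliceExpansion_coeff_zero {m : ℕ} (a : ℕ → κ → ℝ → ℝ → ℝ) :
    (sliceExpansion m a).coeff 0 = 0 := by
  rw [sliceExpansion, coeff_expansion, if_neg (by omega)]

lemma coeff_mul_eq_conv {m k : ℕ} (a b : ℕ → κ → ℝ → ℝ → ℝ) (hk : k ≤ m) :
    (sliceExpansion m a * sliceExpansion m b).coeff (k + 1) =
      slices fun P => conv (fun k => a k P) (fun k => b k P) k := by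
  rw [sliceExpansion, sliceExpansion, coeff_expansion_mul_expansion _ _ hk]
  funext i y
  simp [conv, slices, Finset.sum_apply]

/-- The truncated logarithm has the coefficients `ℓ^{(K)}` up to the order of truncation. -/
lemma sum_coeff_pow_eq_ell {m K : ℕ} (a : ℕ → κ → ℝ → ℝ → ℝ) (hK : K ≤ m) :
    ∑ j ∈ Finset.Icc 1 m, ((-1 : ℝ) ^ (j + 1) / j) • (sliceExpansion m a ^ j).coeff K =
      slices fun P => ell (fun k => a k P) K := by
  have hsub : ∑ j ∈ Finset.Icc 1 m, ((-1 : ℝ) ^ (j + 1) / j) • (sliceExpansion m a ^ j).coeff K =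
      ∑ j ∈ Finset.Icc 1 K, ((-1 : ℝ) ^ (j + 1) / j) • (sliceExpansion m a ^ j).coeff K := by
    symm
    refine Finset.sum_subset (Finset.Icc_subset_Icc_right hK) fun j hj hjK => ?_
    rw [sliceExpansion, coeff_expansion_pow_of_lt _ (by simp at hj hjK; omega), smul_zero]
  rw [hsub]
  funext i y
  simp only [sliceExpansion, coeff_expansion_pow hK, ell, Finset.sum_apply, Pi.smul_apply,
    Pi.mul_apply, Pi.natCast_apply, Finset.prod_apply, Pi.pow_apply, smul_eq_mul, slices]

/-- The brackets of the density and velocity residuals have a common factor `ε^{1/2}`, that of the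
Poisson residual has not; hence the two exponents. -/
lemma uniformL2Bound_of_physical {m : ℕ} {q : (κ × ℝ≥0 → ℝ → ℝ)[X]}
    (hq : HasUniformCoeffs 0 q) (h0 : ∀ k ≤ m, q.coeff k = 0) :
    ∃ C : ℝ, 0 < C ∧ ∀ ε : ℝ, 0 < ε → ε ≤ 1 → ∀ (c : ℝ) (P : κ) (r : ℝ → ℝ → ℝ),
      ((∀ x t, 0 ≤ t → r x t = -ε ^ (1 - (m : ℤ)) * physical c ε P q x t) →
        UniformL2Bound r (C * ε ^ (7 / 4 : ℝ))) ∧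
      ((∀ x t, 0 ≤ t → r x t =
          -ε ^ (1 - (m : ℤ)) * (ε ^ (1 / 2 : ℝ) * physical c ε P q x t)) →
        UniformL2Bound r (C * ε ^ (9 / 4 : ℝ))) := by
  obtain ⟨C, hC, h⟩ := hq.exists_residual_bound h0
  refine ⟨C, hC, fun ε hε hε1 c P r => ⟨fun hr => ?_, fun hr => ?_⟩⟩
  · have hf : ∀ t, 0 ≤ t → (fun x => r x t) = -fun x => ε ^ (1 - (m : ℤ)) *
        evalExpansion ε (slowIndex P ε t) (ε ^ (1 / 2 : ℝ) * (x - c * t)) q := by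
      intro t ht
      funext x
      rw [hr x t ht, Pi.neg_apply, neg_mul]; rfl
    refine ⟨fun t ht => ?_, iSup₂_le fun t ht => ?_⟩
    · rw [hf t ht]
      exact (h ε hε hε1 _ _).1.neg
    · rw [hf t ht, eLpNorm_neg]
      exact (h ε hε hε1 _ _).2
  · have hf : ∀ t, 0 ≤ t → (fun x => r x t) = (-ε ^ (1 / 2 : ℝ)) •
        fun x => ε ^ (1 - (m : ℤ)) *
        evalExpansion ε (slowIndex P ε t) (ε ^ (1 / 2 : ℝ) * (x - c * t)) q := by
      intro t ht
      funext x
      rw [hr x t ht, Pi.smul_apply, smul_eq_mul, physical]; ring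
    refine ⟨fun t ht => ?_, iSup₂_le fun t ht => ?_⟩
    · rw [hf t ht]
      exact (h ε hε hε1 _ _).1.const_smul _
    · rw [hf t ht, eLpNorm_const_smul, enorm_neg, Real.enorm_of_nonneg (by positivity)]
      refine (mul_le_mul' le_rfl (h ε hε hε1 _ _).2).trans (le_of_eq ?_)
      rw [← ENNReal.ofReal_mul (by positivity)]
      congr 1
      rw [mul_left_comm, ← Real.rpow_add hε]
      norm_num

lemma deriv_zero_fun (y : ℝ) : deriv (0 : ℝ → ℝ) y = 0 := deriv_const y 0

/-- The bracket in the residual is `ε^{1/2}` times the value of a polynomial in `ε` whose coefficients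
up to order `m` are the left sides of the continuity equations of the hierarchy. -/
theorem exists_bound_densityResidual {m : ℕ} (c : ℝ)
    {n v : ℕ → κ → ℝ → ℝ → ℝ}
    (hn : ∀ k, 1 ≤ k → k ≤ m → n k ∈ differentiableFamilies κ 2)
    (hv : ∀ k, 1 ≤ k → k ≤ m → v k ∈ differentiableFamilies κ 2)
    (h1 : ∀ P y T, 0 ≤ T → dSpace (v 1 P) y T - c * dSpace (n 1 P) y T = 0)
    (hk : ∀ k, 1 ≤ k → k + 1 ≤ m → ∀ P y T, 0 ≤ T →
      dTime (n k P) y T + dSpace (v (k + 1) P) y T +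
        dSpace (conv (fun k => n k P) (fun k => v k P) k) y T
        - c * dSpace (n (k + 1) P) y T = 0) :
    ∃ C : ℝ, 0 < C ∧ ∀ (P : κ) (ε : ℝ), 0 < ε → ε ≤ 1 →
      UniformL2Bound (densityResidual ε m (truncatedDensity c ε m fun k => n k P)
        (truncated c ε m fun k => v k P)) (C * ε ^ (9 / 4 : ℝ)) := by
  have un : HasUniformCoeffs 2 (sliceExpansion m n) :=
    hasUniformCoeffs_sliceExpansion fun k h1 hm => (hn k h1 hm).1
  have uv : HasUniformCoeffs 2 (sliceExpansion m v) :=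
    hasUniformCoeffs_sliceExpansion fun k h1 hm => (hv k h1 hm).1
  have ut : HasUniformCoeffs 2 (sliceExpansion m fun k P => dTime (n k P)) :=
    hasUniformCoeffs_sliceExpansion fun k h1 hm => (dTime_spec (hn k h1 hm)).1
  set q : (κ × ℝ≥0 → ℝ → ℝ)[X] := (-(c • spaceDeriv (sliceExpansion m n)) +
    X * sliceExpansion m fun k P => dTime (n k P)) +
    (spaceDeriv (sliceExpansion m v) + spaceDeriv (sliceExpansion m n * sliceExpansion m v))
    with hq
  have uq : HasUniformCoeffs 0 q := by
    rw [hq, ← neg_smul]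
    exact (((un.spaceDeriv.smul _).of_le (by omega)).add (ut.X_mul.of_le (by omega))).add
      ((uv.spaceDeriv.of_le (by omega)).add ((un.mul uv).spaceDeriv.of_le (by omega)))
  have q0 : ∀ k ≤ m, q.coeff k = 0 := by
    intro k hkm
    funext i y
    simp only [hq, coeff_add, coeff_neg, coeff_smul, Pi.add_apply, Pi.neg_apply, Pi.smul_apply,
      smul_eq_mul, spaceDeriv_apply_coeff, Pi.zero_apply]
    match k, hkm with
    | 0, _ =>
      rw [coeff_X_mul_zero, sliceExpansion_coeff_zero, sliceExpansion_coeff_zero, sliceExpansion,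
        sliceExpansion, coeff_expansion_mul_expansion_of_le_one _ _ (by omega)]
      simp
    | 1, hkm =>
      rw [coeff_X_mul, sliceExpansion_coeff_zero, sliceExpansion_coeff _ le_rfl hkm,
        sliceExpansion_coeff _ le_rfl hkm, sliceExpansion,
        sliceExpansion, coeff_expansion_mul_expansion_of_le_one _ _ le_rfl]
      simp only [Pi.zero_apply, deriv_zero_fun]
      have := h1 i.1 y i.2 i.2.2
      simp only [deriv_slices]
      linarith
    | k + 2, hkm =>
      rw [coeff_X_mul, sliceExpansion_coeff n (by omega) hkm,
        sliceExpansion_coeff v (by omega) hkm,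
        sliceExpansion_coeff (fun k P => dTime (n k P)) (by omega) (by omega),
        coeff_mul_eq_conv _ _ (by omega)]
      have := hk (k + 1) (by omega) hkm i.1 y i.2 i.2.2
      simp only [deriv_slices, slices_apply]
      linarith
  obtain ⟨C, hC, h⟩ := uniformL2Bound_of_physical uq q0
  refine ⟨C, hC, fun P ε hε hε1 => (h ε hε hε1 c P _).2 fun x t ht => ?_⟩
  rw [densityResidual]
  congr 1
  have e1 : dTime (truncatedDensity c ε m fun k => n k P) x t = _ :=
    ((hasDerivWithinAt_truncated hn c hε P x ht).const_add 1).derivWithin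
      (uniqueDiffOn_Ici 0 t ht)
  have hV : ∀ x, truncated c ε m (fun k => v k P) x t = _ :=
    fun x => truncated_eq_physical v c hε P x ht
  have e2 := dSpace_eq_physical (c := c) (ε := ε) (P := P)
    ((uv.of_le one_le_two).add ((un.mul uv).of_le one_le_two))
    (u := fun x t => truncatedDensity c ε m (fun k => n k P) x t *
      truncated c ε m (fun k => v k P) x t) (t := t) (by
    intro x
    simp only [truncatedDensity, truncated_eq_physical n c hε P x ht, hV x, physical, map_add,
      map_mul]
    ring) x
  have e3 : spaceDeriv (sliceExpansion m v + sliceExpansion m n * sliceExpansion m v) =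
      spaceDeriv (sliceExpansion m v) + spaceDeriv (sliceExpansion m n * sliceExpansion m v) := by
    ext k i y
    simp only [spaceDeriv_apply_coeff, coeff_add, Pi.add_apply]
    exact deriv_add (uv.differentiable k i y) ((un.mul uv).differentiable k i y)
  rw [e1, e2, e3, hq, ← mul_add]
  simp only [physical, map_add]

/-- The bracket in the residual is `ε^{1/2}` times the value of a polynomial in `ε` whose coefficients
up to order `m` are the left sides of the momentum equations of the hierarchy. -/
theorem exists_bound_velocityResidual {m : ℕ} (hm : 1 ≤ m) (c μ θ σ : ℝ)
    {n v φ : ℕ → κ → ℝ → ℝ → ℝ}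
    (hn : ∀ k, 1 ≤ k → k ≤ m → n k ∈ differentiableFamilies κ 2)
    (hv : ∀ k, 1 ≤ k → k ≤ m → v k ∈ differentiableFamilies κ 2)
    (hφ : ∀ k, 1 ≤ k → k ≤ m → slices (φ k) ∈ uniformFamilies (κ × ℝ≥0) 2)
    (h1 : ∀ P y T, 0 ≤ T → θ * dSpace (n 1 P) y T - c * μ * dSpace (v 1 P) y T +
      σ * dSpace (φ 1 P) y T = 0)
    (hk : ∀ k, 1 ≤ k → k + 1 ≤ m → ∀ P y T, 0 ≤ T →
      μ * (dTime (v k P) y T - c * dSpace (v (k + 1) P) y T +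
        1 / 2 * dSpace (conv (fun k => v k P) (fun k => v k P) k) y T) +
        θ * dSpace (ell (fun k => n k P) (k + 1)) y T + σ * dSpace (φ (k + 1) P) y T = 0) :
    ∃ C : ℝ, 0 < C ∧ ∀ (P : κ) (ε : ℝ), 0 < ε → ε ≤ 1 →
      UniformL2Bound (velocityResidual μ θ σ ε m (truncatedDensity c ε m fun k => n k P)
        (truncated c ε m fun k => v k P) (truncated c ε m fun k => φ k P))
        (C * ε ^ (9 / 4 : ℝ)) := by
  have un : HasUniformCoeffs 2 (sliceExpansion m n) :=
    hasUniformCoeffs_sliceExpansion fun k h1 hm => (hn k h1 hm).1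
  have uv : HasUniformCoeffs 2 (sliceExpansion m v) :=
    hasUniformCoeffs_sliceExpansion fun k h1 hm => (hv k h1 hm).1
  have uφ : HasUniformCoeffs 2 (sliceExpansion m φ) := hasUniformCoeffs_expansion hφ
  have ut : HasUniformCoeffs 2 (sliceExpansion m fun k P => dTime (v k P)) :=
    hasUniformCoeffs_sliceExpansion fun k h1 hm => (dTime_spec (hv k h1 hm)).1
  have uv2 : HasUniformCoeffs 2 (sliceExpansion m v ^ 2) := uv.pow one_le_two
  have upow : ∀ j ∈ Finset.Icc 1 m, HasUniformCoeffs 2 (sliceExpansion m n ^ j) :=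
    fun j hj => un.pow (Finset.mem_Icc.mp hj).1
  set q : (κ × ℝ≥0 → ℝ → ℝ)[X] := μ • ((-(c • spaceDeriv (sliceExpansion m v)) +
    X * sliceExpansion m fun k P => dTime (v k P)) +
    (1 / 2 : ℝ) • spaceDeriv (sliceExpansion m v ^ 2)) +
    θ • ∑ j ∈ Finset.Icc 1 m, ((-1 : ℝ) ^ (j + 1) / j) • spaceDeriv (sliceExpansion m n ^ j) +
    σ • spaceDeriv (sliceExpansion m φ) with hq
  have uq : HasUniformCoeffs 0 q := by
    rw [hq, ← neg_smul]
    refine HasUniformCoeffs.of_le (r' := 1) (by omega) ?_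
    exact (((((uv.spaceDeriv.smul _).add (ut.X_mul.of_le one_le_two)).add
      (uv2.spaceDeriv.smul _)).smul μ).add
      ((HasUniformCoeffs.sum fun j hj => (upow j hj).spaceDeriv.smul _).smul θ)).add
      (uφ.spaceDeriv.smul σ)
  have hsum : ∀ k ≤ m, ∀ i y, ∑ j ∈ Finset.Icc 1 m, ((-1 : ℝ) ^ (j + 1) / j) *
      deriv ((sliceExpansion m n ^ j).coeff k i) y =
      dSpace (ell (fun k => n k i.1) k) y i.2 := by
    intro k hkm i y
    rw [← deriv_slices fun P => ell (fun k => n k P) k, ← sum_coeff_pow_eq_ell n hkm, Finset.sum_apply, deriv_sum]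
    · refine Finset.sum_congr rfl fun j hj => ?_
      rw [Pi.smul_apply, deriv_const_smul _ ((upow j hj).differentiable k i y), smul_eq_mul]
    · exact fun j hj => ((upow j hj).differentiable k i y).const_smul ((-1 : ℝ) ^ (j + 1) / j)
  have q0 : ∀ k ≤ m, q.coeff k = 0 := by
    intro k hkm
    funext i y
    simp only [hq, coeff_add, coeff_neg, coeff_smul, finsetSum_coeff, Finset.sum_apply,
      Pi.add_apply, Pi.neg_apply, Pi.smul_apply, smul_eq_mul, spaceDeriv_apply_coeff,
      Pi.zero_apply]
    rw [hsum k hkm, pow_two]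
    match k, hkm with
    | 0, _ =>
      rw [coeff_X_mul_zero, sliceExpansion_coeff_zero, sliceExpansion_coeff_zero, sliceExpansion,
        coeff_expansion_mul_expansion_of_le_one _ _ (by omega)]
      simp [dSpace, ell]
    | 1, hkm =>
      have hell : (slices fun P => ell (fun k => n k P) 1) = slices (n 1) := by
        rw [← sum_coeff_pow_eq_ell n hkm, Finset.sum_eq_single_of_mem 1
          (Finset.mem_Icc.mpr ⟨le_rfl, hm⟩), pow_one, sliceExpansion_coeff _ le_rfl hkm]
        · simp
        · intro j hj hj1
          rw [sliceExpansion, coeff_expansion_pow_of_lt _ (by simp at hj; omega), smul_zero]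
      rw [← deriv_slices fun P => ell (fun k => n k P) 1, hell, coeff_X_mul, sliceExpansion_coeff_zero, sliceExpansion_coeff _ le_rfl hkm,
        sliceExpansion_coeff _ le_rfl hkm, sliceExpansion,
        coeff_expansion_mul_expansion_of_le_one _ _ le_rfl]
      simp only [Pi.zero_apply, deriv_zero_fun]
      have := h1 i.1 y i.2 i.2.2
      simp only [deriv_slices]
      linarith
    | k + 2, hkm =>
      rw [coeff_X_mul, sliceExpansion_coeff v (by omega) hkm,
        sliceExpansion_coeff φ (by omega) hkm,
        sliceExpansion_coeff (fun k P => dTime (v k P)) (by omega) (by omega),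
        coeff_mul_eq_conv _ _ (by omega)]
      have := hk (k + 1) (by omega) hkm i.1 y i.2 i.2.2
      simp only [deriv_slices, slices_apply]
      linarith
  obtain ⟨C, hC, h⟩ := uniformL2Bound_of_physical uq q0
  refine ⟨C, hC, fun P ε hε hε1 => (h ε hε hε1 c P _).2 fun x t ht => ?_⟩
  rw [velocityResidual]
  congr 1
  have e1 : dTime (truncated c ε m fun k => v k P) x t = _ :=
    (hasDerivWithinAt_truncated hv c hε P x ht).derivWithin (uniqueDiffOn_Ici 0 t ht)
  have e2 := dSpace_eq_physical (c := c) (ε := ε) (P := P) (uv2.of_le one_le_two)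
    (u := fun x t => truncated c ε m (fun k => v k P) x t ^ 2) (t := t) (fun x => by
    simp only [truncated_eq_physical v c hε P x ht, physical, map_pow]) x
  have e3 : ∀ j ∈ Finset.Icc 1 m, dSpace
      (fun x t => (truncatedDensity c ε m (fun k => n k P) x t - 1) ^ j) x t =
      ε ^ (1 / 2 : ℝ) * physical c ε P (spaceDeriv (sliceExpansion m n ^ j)) x t := fun j hj =>
    dSpace_eq_physical ((upow j hj).of_le one_le_two) (fun x => by
    simp only [truncatedDensity, truncated_eq_physical n c hε P x ht, physical, map_pow,
      add_sub_cancel_left]) x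
  have e4 := dSpace_eq_physical (c := c) (ε := ε) (P := P) (uφ.of_le one_le_two)
    (u := truncated c ε m fun k => φ k P) (fun x => truncated_eq_physical φ c hε P x ht) x
  have e5 : ∑ j ∈ Finset.Icc 1 m, ((-1 : ℝ) ^ (j + 1) / j) * dSpace
      (fun x t => (truncatedDensity c ε m (fun k => n k P) x t - 1) ^ j) x t =
      ε ^ (1 / 2 : ℝ) * ∑ j ∈ Finset.Icc 1 m, ((-1 : ℝ) ^ (j + 1) / j) *
        physical c ε P (spaceDeriv (sliceExpansion m n ^ j)) x t := by
    rw [Finset.mul_sum]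
    refine Finset.sum_congr rfl fun j hj => ?_
    rw [e3 j hj]; ring
  rw [e1, e2, e4, e5, hq]
  simp only [physical, map_add, map_smul, map_sum, smul_eq_mul]
  ring

/-- There is no common factor `ε^{1/2}` here: `∂_x²` gives a full power of `ε`, which shifts the index
of `φ` by one. -/
theorem exists_bound_poissonResidual {m : ℕ} (c : ℝ) {n n' φ : ℕ → κ → ℝ → ℝ → ℝ}
    (hn : ∀ k, 1 ≤ k → k ≤ m → n k ∈ differentiableFamilies κ 2)
    (hn' : ∀ k, 1 ≤ k → k ≤ m → n' k ∈ differentiableFamilies κ 2)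
    (hφ : ∀ k, 1 ≤ k → k ≤ m → slices (φ k) ∈ uniformFamilies (κ × ℝ≥0) 2)
    (h1 : ∀ P y T, 0 ≤ T → n 1 P y T - n' 1 P y T = 0)
    (hk : ∀ k, 1 ≤ k → k + 1 ≤ m → ∀ P y T, 0 ≤ T →
      dSpace (dSpace (φ k P)) y T + n (k + 1) P y T - n' (k + 1) P y T = 0) :
    ∃ C : ℝ, 0 < C ∧ ∀ (P : κ) (ε : ℝ), 0 < ε → ε ≤ 1 →
      UniformL2Bound (poissonResidual ε m (truncatedDensity c ε m fun k => n k P)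
        (truncatedDensity c ε m fun k => n' k P) (truncated c ε m fun k => φ k P))
        (C * ε ^ (7 / 4 : ℝ)) := by
  have un : HasUniformCoeffs 2 (sliceExpansion m n) :=
    hasUniformCoeffs_sliceExpansion fun k h1 hm => (hn k h1 hm).1
  have un' : HasUniformCoeffs 2 (sliceExpansion m n') :=
    hasUniformCoeffs_sliceExpansion fun k h1 hm => (hn' k h1 hm).1
  have uφ : HasUniformCoeffs 2 (sliceExpansion m φ) := hasUniformCoeffs_expansion hφ
  set q : (κ × ℝ≥0 → ℝ → ℝ)[X] := X * spaceDeriv (spaceDeriv (sliceExpansion m φ)) +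
    (-1 : ℝ) • sliceExpansion m n' + sliceExpansion m n with hq
  have uq : HasUniformCoeffs 0 q :=
    (uφ.spaceDeriv.spaceDeriv.X_mul.add ((un'.smul _).of_le (by omega))).add
      (un.of_le (by omega))
  have q0 : ∀ k ≤ m, q.coeff k = 0 := by
    intro k hkm
    funext i y
    simp only [hq, coeff_add, coeff_smul, Pi.add_apply, Pi.smul_apply, smul_eq_mul,
      Pi.zero_apply]
    match k, hkm with
    | 0, _ =>
      rw [coeff_X_mul_zero, sliceExpansion_coeff_zero, sliceExpansion_coeff_zero]
      simp
    | 1, hkm =>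
      rw [coeff_X_mul, sliceExpansion_coeff _ le_rfl hkm, sliceExpansion_coeff _ le_rfl hkm,
        coeff_spaceDeriv, coeff_spaceDeriv, sliceExpansion_coeff_zero]
      have := h1 i.1 y i.2 i.2.2
      have hz : deriv (fun y => deriv ((0 : κ × ℝ≥0 → ℝ → ℝ) i) y) y = 0 := by
        simp only [Pi.zero_apply, deriv_zero_fun, deriv_const]
      simp only [slices]
      change deriv (fun y => deriv ((0 : κ × ℝ≥0 → ℝ → ℝ) i) y) y + _ + _ = 0
      rw [hz]
      linarith
    | k + 2, hkm =>
      rw [coeff_X_mul, sliceExpansion_coeff _ (by omega) hkm,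
        sliceExpansion_coeff _ (by omega) hkm, coeff_spaceDeriv, coeff_spaceDeriv,
        sliceExpansion_coeff _ (by omega) (by omega)]
      have := hk (k + 1) (by omega) hkm i.1 y i.2 i.2.2
      simp only [slices]
      change dSpace (dSpace (φ (k + 1) i.1)) y i.2 + _ + _ = 0
      linarith
  obtain ⟨C, hC, h⟩ := uniformL2Bound_of_physical uq q0
  refine ⟨C, hC, fun P ε hε hε1 => (h ε hε hε1 c P _).1 fun x t ht => ?_⟩
  rw [poissonResidual]
  congr 1
  have e1 := fun x => dSpace_eq_physical (c := c) (ε := ε) (P := P) (uφ.of_le one_le_two)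
    (u := truncated c ε m fun k => φ k P) (fun x => truncated_eq_physical φ c hε P x ht) x
  have e2 : dSpace (dSpace (truncated c ε m fun k => φ k P)) x t =
      ε * physical c ε P (spaceDeriv (spaceDeriv (sliceExpansion m φ))) x t := by
    have := dSpace_eq_physical (c := c) (ε := ε) (P := P) (uφ.spaceDeriv.smul (ε ^ (1 / 2 : ℝ)))
      (u := dSpace (truncated c ε m fun k => φ k P)) (t := t) (fun x => by
        rw [e1 x]; simp only [physical, map_smul, smul_eq_mul]) x
    have hs : spaceDeriv (ε ^ (1 / 2 : ℝ) • spaceDeriv (sliceExpansion m φ)) =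
        ε ^ (1 / 2 : ℝ) • spaceDeriv (spaceDeriv (sliceExpansion m φ)) := by
      ext k i y
      have hd := uφ.spaceDeriv.differentiable k i y
      simp only [coeff_spaceDeriv, coeff_smul, Pi.smul_apply] at hd ⊢
      exact deriv_const_smul _ hd
    rw [this, hs]
    simp only [physical, map_smul, smul_eq_mul]
    rw [← mul_assoc, ← Real.rpow_add hε]
    norm_num
  simp only [truncatedDensity]
  rw [e2, truncated_eq_physical n c hε P x ht, truncated_eq_physical n' c hε P x ht, hq]
  simp only [physical, map_add, map_smul, map_mul, evalExpansion_X, smul_eq_mul]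
  ring

end

end EulerPoisson

namespace EulerPoisson

/-! ### The estimate -/

lemma UniformL2Bound.mono {r : ℝ → ℝ → ℝ} {A B : ℝ} (h : UniformL2Bound r A) (hAB : A ≤ B) :
    UniformL2Bound r B :=
  ⟨h.1, h.2.trans (ENNReal.ofReal_le_ofReal hAB)⟩

end EulerPoisson

theorem mainTheorem2 (τi me : ℝ) (hτi : 0 ≤ τi) (hme : 0 < me) (m : ℕ) (hm : 1 ≤ m)
    (R : EulerPoisson.LocalRelations) :
    ∃ s₀ : ℕ, ∀ s : ℕ, s₀ ≤ s → ∀ M : NNReal, ∃ C : ℝ, 0 < C ∧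
      ∀ P : EulerPoisson.Profiles, EulerPoisson.IsApproximateSolution τi me m R P →
        (⨆ T ∈ Set.Ici (0 : ℝ), EulerPoisson.profileNorm s m P T) ≤ (M : ENNReal) →
        ∀ ε : ℝ, 0 < ε → ε ≤ 1 →
          let c := EulerPoisson.soundSpeed τi me
          let NP := EulerPoisson.truncatedDensity c ε m P.nP
          let NM := EulerPoisson.truncatedDensity c ε m P.nM
          let VP := EulerPoisson.truncated c ε m P.vP
          let VM := EulerPoisson.truncated c ε m P.vM
          let Φ := EulerPoisson.truncated c ε m P.φ
          EulerPoisson.UniformL2Bound (EulerPoisson.densityResidual ε m NP VP)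
            (C * ε ^ (9 / 4 : ℝ)) ∧
          EulerPoisson.UniformL2Bound (EulerPoisson.densityResidual ε m NM VM)
            (C * ε ^ (9 / 4 : ℝ)) ∧
          EulerPoisson.UniformL2Bound (EulerPoisson.velocityResidual 1 τi 1 ε m NP VP Φ)
            (C * ε ^ (9 / 4 : ℝ)) ∧
          EulerPoisson.UniformL2Bound (EulerPoisson.velocityResidual me 1 (-1) ε m NM VM Φ)
            (C * ε ^ (9 / 4 : ℝ)) ∧
          EulerPoisson.UniformL2Bound (EulerPoisson.poissonResidual ε m NP NM Φ)
            (C * ε ^ (7 / 4 : ℝ)) := by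
  -- One derivative is lost in the Sobolev embedding, `jetOrder` derivatives in expressing the time
  -- derivative of a density by the KdV equation and as many again in a slaving relation; two are
  -- left for the residuals.
  refine ⟨2 * EulerPoisson.jetOrder m R + 3, fun s hs M => ?_⟩
  have hP : ∀ k, 1 ≤ k → k ≤ m →
      (fun (P : EulerPoisson.BoundedSolution τi me m R s M) => P.1.nP k) ∈
        EulerPoisson.differentiableFamilies _ 2 :=
    fun k h1 hk => EulerPoisson.density_mem_differentiableFamilies one_le_two (by omega) h1 hk
  have hS := fun k h1 hk => EulerPoisson.slaved_mem_differentiableFamilies (τi := τi) (me := me)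
    (m := m) (R := R) (s := s) (M := M) (r := 2) one_le_two (by omega) (k := k) h1 hk
  have hφ : ∀ k, 1 ≤ k → k ≤ m →
      EulerPoisson.slices (fun (P : EulerPoisson.BoundedSolution τi me m R s M) => P.1.φ k) ∈
        EulerPoisson.uniformFamilies _ 2 :=
    fun k h1 hk => EulerPoisson.potential_mem_uniformFamilies (by omega) h1 hk
  obtain ⟨C₁, hC₁, b₁⟩ := EulerPoisson.exists_bound_densityResidual
    (κ := EulerPoisson.BoundedSolution τi me m R s M) (EulerPoisson.soundSpeed τi me) (n := fun k P => P.1.nP k) (v := fun k P => P.1.vP k) hP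
    (fun k h1 hk => (hS k h1 hk).2.1)
    (fun P y T hT => (P.2.1.evolution_zero y T hT).1)
    (fun k h1 hk P y T hT => (P.2.1.evolution k h1 hk y T hT).1)
  obtain ⟨C₂, hC₂, b₂⟩ := EulerPoisson.exists_bound_densityResidual
    (κ := EulerPoisson.BoundedSolution τi me m R s M) (EulerPoisson.soundSpeed τi me) (n := fun k P => P.1.nM k) (v := fun k P => P.1.vM k)
    (fun k h1 hk => (hS k h1 hk).1) (fun k h1 hk => (hS k h1 hk).2.2)
    (fun P y T hT => (P.2.1.evolution_zero y T hT).2.1)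
    (fun k h1 hk P y T hT => (P.2.1.evolution k h1 hk y T hT).2.1)
  obtain ⟨C₃, hC₃, b₃⟩ := EulerPoisson.exists_bound_velocityResidual hm
    (κ := EulerPoisson.BoundedSolution τi me m R s M) (EulerPoisson.soundSpeed τi me) 1 τi 1 (n := fun k P => P.1.nP k)
    (v := fun k P => P.1.vP k) (φ := fun k P => P.1.φ k) hP
    (fun k h1 hk => (hS k h1 hk).2.1) hφ
    (fun P y T hT => by linarith [(P.2.1.evolution_zero y T hT).2.2.1])
    (fun k h1 hk P y T hT => by linarith [(P.2.1.evolution k h1 hk y T hT).2.2.1])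
  obtain ⟨C₄, hC₄, b₄⟩ := EulerPoisson.exists_bound_velocityResidual hm
    (κ := EulerPoisson.BoundedSolution τi me m R s M) (EulerPoisson.soundSpeed τi me) me 1 (-1) (n := fun k P => P.1.nM k)
    (v := fun k P => P.1.vM k) (φ := fun k P => P.1.φ k) (fun k h1 hk => (hS k h1 hk).1)
    (fun k h1 hk => (hS k h1 hk).2.2) hφ
    (fun P y T hT => by linarith [(P.2.1.evolution_zero y T hT).2.2.2.1])
    (fun k h1 hk P y T hT => by linarith [(P.2.1.evolution k h1 hk y T hT).2.2.2.1])
  obtain ⟨C₅, hC₅, b₅⟩ := EulerPoisson.exists_bound_poissonResidual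
    (κ := EulerPoisson.BoundedSolution τi me m R s M) (EulerPoisson.soundSpeed τi me) (n := fun k P => P.1.nP k) (n' := fun k P => P.1.nM k)
    (φ := fun k P => P.1.φ k) hP (fun k h1 hk => (hS k h1 hk).1) hφ
    (fun P y T hT => (P.2.1.evolution_zero y T hT).2.2.2.2)
    (fun k h1 hk P y T hT => (P.2.1.evolution k h1 hk y T hT).2.2.2.2)
  refine ⟨C₁ + C₂ + C₃ + C₄ + C₅, by positivity, fun P hsol hbd ε hε hε1 => ?_⟩
  let Q : EulerPoisson.BoundedSolution τi me m R s M := ⟨P, hsol, hbd⟩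
  refine ⟨(b₁ Q ε hε hε1).mono ?_, (b₂ Q ε hε hε1).mono ?_, (b₃ Q ε hε hε1).mono ?_,
    (b₄ Q ε hε hε1).mono ?_, (b₅ Q ε hε hε1).mono ?_⟩ <;>
  exact mul_le_mul_of_nonneg_right (by linarith) (by positivity)
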